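/- Let $Z_+\in\mathbb R$ and $\mu\in\mathbb C$, and put $q(\tau)=\frac{\mu}{1+\tau^2}-\frac{Z_+}{\sqrt{1+\tau^2}}$ for $\tau>0$. For an integer $j\ge 1$ let $\Omega_j=\{k\in\mathbb C: |k|^2>1/j\}$, and call a real function $l\in C^2((0,\infty))$ an admissible long range part of level $j$ if $|l|\le 1/j$ on $(0,\infty)$, $l(\tau)=-Z_+/\sqrt{1+\tau^2}$ for all large $\tau$, and $q-l\in L^1((0,\infty))$. A global phase function is a function $\phi(\xi,k)$ such that for every $j\ge1$ there are an admissible long range part $l_j$ of level $j$, an analytic function $g_j$ on $\Omega_j$ and a number $\widetilde R_j$ with $$\phi(\xi,k)=\int_0^{\sinh\xi}\sqrt{k^2-l_j(\tau)}\,d\tau+g_j(k)\qquad\text{for }\xi>\widetilde R_j,\ k\in\Omega_j,$$ where $\sqrt{k^2-l}:=k\sqrt{1-l/k^2}$ with the principal square root on the right, and such that for every $k\ne0$ one has $\phi(\xi,-k)=-\phi(\xi,k)$ for all large $\xi$. Let $\phi$ be a global phase function, let $\mathbb C_{+}$ and $\mathbb C_-$ be the open upper and lower half-planes, and consider, for $\xi>0$,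 the radial equation $$v''(\xi)+\bigl(k^2\cosh^2\xi+Z_+\cosh\xi-\mu\bigr)v(\xi)=0.\tag{1}$$ For each choice of the sign $\pm$ there is a family $v_\pm(\xi,k)$, $\xi>0$, $k\in\mathbb C\setminus\{0\}$, with the following properties. 1. For every $k\in\mathbb C\setminus\{0\}$ the function $v_\pm(\cdot,k)$ solves (1) and $$v_\pm(\xi,k)=\sqrt2\,e^{-\xi/2}\exp\bigl(\pm i\phi(\xi,k)\bigr)\,(1+o(1))\qquad\text{as }\xi\to\infty.\tag{2}$$ 2. For every $k\in\overline{\mathbb C}_\pm\setminus\{0\}$ it is the only solution of (1) on $(0,\infty)$ satisfying (2). 3. For all $\eta\ge0$ and $\delta>0$, (2) holds uniformly for $k$ in the truncated cone $\Lambda_\pm(\eta,\delta)=\{k\in\mathbb C\setminus\{0\}:\eta\le\arg(\pm k)\le\pi-\eta,\ |k|\ge\delta\}$, where $\arg$ takes values in $(-\pi,\pi]$. 4. For every $\xi>0$ the function $k\mapsto v_\pm(\xi,k)$ is analytic in $\mathbb C_\pm$ and continuous on $\overline{\mathbb C}_\pm\setminus\{0\}$. -/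

import Mathlib

open Filter Topology Set MeasureTheory

noncomputable section

namespace TwoCentre

/-- `v` is a solution on `ξ > 0` of the radial equation
`v'' + (k² cosh² ξ + Z cosh ξ - μ) v = 0`; the witness `v'` is its first derivative. -/
def IsRadialSolution (Z : ℝ) (μ k : ℂ) (v : ℝ → ℂ) : Prop :=
  ∃ v' : ℝ → ℂ, ∀ ξ : ℝ, 0 < ξ →
    HasDerivAt v (v' ξ) ξ ∧
    HasDerivAt v' (-((k ^ 2 * (Real.cosh ξ : ℂ) ^ 2 + (Z : ℂ) * (Real.cosh ξ : ℂ) - μ) * v ξ)) ξ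

/-- The potential `q(τ) = μ / (1 + τ²) - Z / √(1 + τ²)` in the variable `τ = sinh ξ`. -/
def potential (Z : ℝ) (μ : ℂ) (τ : ℝ) : ℂ :=
  μ / (1 + (τ : ℂ) ^ 2) - ((Z / Real.sqrt (1 + τ ^ 2) : ℝ) : ℂ)

/-- `l` is an admissible long range part of level `j`: `q = s + l` on `(0, ∞)` with `s` in `L¹`,
`l` real and of class `C²`, `|l| ≤ 1 / j`, and `l(τ) = -Z / √(1 + τ²)` for large `τ`. -/
structure IsLongRangePart (Z : ℝ) (μ : ℂ) (j : ℕ) (l : ℝ → ℝ) : Prop where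
  contDiffOn : ContDiffOn ℝ 2 l (Ioi 0)
  abs_le : ∀ τ : ℝ, 0 < τ → |l τ| ≤ 1 / (j : ℝ)
  eq_of_large : ∃ R : ℝ, ∀ τ : ℝ, R < τ → l τ = -(Z / Real.sqrt (1 + τ ^ 2))
  shortRange_integrable : IntegrableOn (fun τ : ℝ => potential Z μ τ - (l τ : ℂ)) (Ioi 0)

/-- `Ω_j = {k : |k|² > 1 / j}`. -/
def Omega (j : ℕ) : Set ℂ := {k : ℂ | 1 / (j : ℝ) < ‖k‖ ^ 2}

/-- The phase `∫₀^{sinh ξ} √(k² - l(τ)) dτ`. The square root is the branch that is analytic in `k`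
on `|k|² > sup |l|` and positive for large positive `k`, that is `k √(1 - l / k²)` with the
principal root. -/
def localPhase (l : ℝ → ℝ) (ξ : ℝ) (k : ℂ) : ℂ :=
  ∫ τ in (0 : ℝ)..Real.sinh ξ, k * (1 - (l τ : ℂ) / k ^ 2) ^ (1 / 2 : ℂ)

/-- `φ(ξ, k)` is a global phase function: for every `j ≥ 1` it agrees, for large `ξ` and all
`k ∈ Ω_j`, with the phase of an admissible long range part of level `j` up to a function analytic in
`Ω_j`, and it is odd in `k`. For each `k` only the germ of `φ(·, k)` at infinity matters. -/
structure IsGlobalPhase (Z : ℝ) (μ : ℂ) (φ : ℝ → ℂ → ℂ) : Prop where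
  patch : ∀ j : ℕ, 1 ≤ j → ∃ l : ℝ → ℝ, IsLongRangePart Z μ j l ∧
    ∃ g : ℂ → ℂ, AnalyticOnNhd ℂ g (Omega j) ∧
      ∃ R : ℝ, ∀ ξ : ℝ, R < ξ → ∀ k ∈ Omega j, φ ξ k = localPhase l ξ k + g k
  odd : ∀ k : ℂ, k ≠ 0 → ∀ᶠ ξ : ℝ in atTop, φ ξ (-k) = -φ ξ k

/-- The leading term `√2 e^{-ξ/2} exp(σ i φ(ξ, k))`, for a sign `σ = ±1`. -/
def leadingTerm (σ : ℝ) (φ : ℝ → ℂ → ℂ) (ξ : ℝ) (k : ℂ) : ℂ :=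
  ((Real.sqrt 2 * Real.exp (-ξ / 2) : ℝ) : ℂ) * Complex.exp ((σ : ℂ) * Complex.I * φ ξ k)

/-- `v(ξ) = √2 e^{-ξ/2} exp(σ i φ(ξ, k)) (1 + o(1))` as `ξ → ∞`. -/
def HasAsymptotics (σ : ℝ) (φ : ℝ → ℂ → ℂ) (k : ℂ) (v : ℝ → ℂ) : Prop :=
  Tendsto (fun ξ : ℝ => v ξ / leadingTerm σ φ ξ k) atTop (𝓝 1)

/-- The truncated cone `Λ_σ(η, δ)`. -/
def truncatedCone (σ η δ : ℝ) : Set ℂ :=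
  {k : ℂ | k ≠ 0 ∧ η ≤ Complex.arg ((σ : ℂ) * k) ∧ Complex.arg ((σ : ℂ) * k) ≤ Real.pi - η ∧
    δ ≤ ‖k‖}

/-- The open upper (`σ = 1`) or lower (`σ = -1`) half-plane. -/
def halfPlane (σ : ℝ) : Set ℂ := {k : ℂ | 0 < σ * k.im}

end TwoCentre

end

/-! Let $\psi=k\sinh\xi+Z\xi/(2k)$. The function $y=(\cosh\xi)^{-1/2}e^{i\psi}$ solves the radial
equation up to a bounded multiple $F$ of itself (`residual`). A product $ym$ with $m'=b\cosh\xi$ is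
a solution as soon as $b'=-2i\psi'b-(F/\cosh\xi)m$. In $m+b/(2ik)$ the growing terms $b\cosh\xi$
cancel on differentiation, and $b$ turns out to be $O(e^{-\xi})$, so $(m+b/(2ik),\,e^{\xi/2}b)$ is
sought from a Volterra equation on $[\xi,\infty)$. Its kernel is $O(e^{-(\xi+s)/2})$ uniformly for
$\operatorname{Im}k\ge0$, $|k|\ge\delta$ (`exists_isVolterraKernel_jostKernel`), because
$e^{2i(\psi(t)-\psi(\xi))}$ stays bounded for $t\ge\xi$. Picard iteration then yields $m\to1$
uniformly, with continuity in $k$, and analyticity in the open half-plane.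

For $\operatorname{Im}k<0$ a solution asymptotic to $y$ comes from reduction of order, starting from
the decaying solution at $-k$ (`exists_growing_solution`). Uniqueness for $\operatorname{Im}k\ge0$
holds because two different solutions with the same leading term would force $e^{-2i\psi}$ to
converge (`not_tendsto_exp_phase`, `IsRadialPair.eq_of_tendsto`).

Expanding the square root in the phase shows $\phi-\psi\to\Theta(k)$ uniformly on $|k|\ge\delta$,
with $\Theta$ analytic off $0$ (`IsGlobalPhase.exists_limit_sub_phase`). The equation is even and
$\psi$ odd in $k$, so both signs are served by $v_\sigma(\xi,k)=e^{i\sigma\Theta(k)}V(\xi,\sigma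
k)$, where $V$ is the solution normalised by $y$. -/

noncomputable section

namespace TwoCentre

/-! ### Volterra equations with an exponentially decaying kernel, depending on a parameter -/

section VolterraEquation

section Volterra

variable {E : Type*} [NormedAddCommGroup E] [NormedSpace ℂ E]

/-- An integral of holomorphic functions with an integrable bound is holomorphic. -/
theorem differentiableOn_integral_of_dominated [CompleteSpace E] {α : Type*}
    [MeasurableSpace α] {ν : Measure α} {U : Set ℂ} (hU : IsOpen U) {f : ℂ → α → E} {bound : α → ℝ}
    (hmeas : ∀ k ∈ U, AEStronglyMeasurable (f k) ν)
    (hdiff : ∀ᵐ x ∂ν, DifferentiableOn ℂ (fun k => f k x) U)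
    (hbound : ∀ᵐ x ∂ν, ∀ k ∈ U, ‖f k x‖ ≤ bound x) (hInt : Integrable bound ν) :
    DifferentiableOn ℂ (fun k => ∫ x, f k x ∂ν) U := by
  intro k hk
  obtain ⟨r, hr, hrU⟩ := Metric.isOpen_iff.1 hU k hk
  have hsub : Metric.ball k (r / 2) ⊆ U :=
    (Metric.ball_subset_ball (by linarith)).trans hrU
  have hsub2 : ∀ z ∈ Metric.ball k (r / 2), Metric.closedBall z (r / 4) ⊆ U := by
    intro z hz w hw
    apply hrU
    rw [Metric.mem_ball] at hz ⊢
    rw [Metric.mem_closedBall] at hw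
    linarith [dist_triangle w z k]
  have hev : ∀ᶠ z in 𝓝 k, z ∈ U := hU.mem_nhds hk
  have hd : ∀ᵐ x ∂ν, ∀ z ∈ Metric.ball k (r / 2),
      HasDerivAt (fun k => f k x) (deriv (fun k => f k x) z) z := by
    filter_upwards [hdiff] with x hx z hz
    exact (hx.differentiableAt (hU.mem_nhds (hsub hz))).hasDerivAt
  have hk2 : k ∈ Metric.ball k (r / 2) := Metric.mem_ball_self (by linarith)
  -- Measurability of the derivative is inherited from difference quotients along a sequence
  -- $z_n\to0$.
  have hmeas' : AEStronglyMeasurable (fun x => deriv (fun k => f k x) k) ν := by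
    let z : ℕ → ℂ := fun n => ((r / 2) / ((n : ℝ) + 2) : ℝ)
    have hzpos : ∀ n : ℕ, 0 < (r / 2) / ((n : ℝ) + 2) := fun n =>
      div_pos (by linarith) (by positivity)
    have hz0 : Tendsto z atTop (𝓝[≠] 0) := by
      refine tendsto_nhdsWithin_iff.2 ⟨?_, Eventually.of_forall fun n => ?_⟩
      · have : Tendsto (fun n : ℕ => (r / 2) / ((n : ℝ) + 2)) atTop (𝓝 0) :=
          Tendsto.const_div_atTop
            (tendsto_atTop_add_const_right _ _ tendsto_natCast_atTop_atTop) _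
        simpa [z, Function.comp_def] using (Complex.continuous_ofReal.tendsto 0).comp this
      · simp only [z, mem_compl_iff, mem_singleton_iff]
        exact_mod_cast (hzpos n).ne'
    have hzU : ∀ n, k + z n ∈ U := by
      intro n
      apply hsub
      rw [Metric.mem_ball, dist_eq_norm, add_sub_cancel_left, Complex.norm_real,
        Real.norm_of_nonneg (hzpos n).le]
      apply div_lt_self (by linarith)
      have : (0 : ℝ) ≤ n := n.cast_nonneg
      linarith
    refine aestronglyMeasurable_of_tendsto_ae atTop
      (f := fun (n : ℕ) x => (z n)⁻¹ • (f (k + z n) x - f k x)) (fun n => ?_) ?_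
    · exact ((hmeas _ (hzU n)).sub (hmeas _ hk)).const_smul _
    · filter_upwards [hd] with x hx
      exact ((hasDerivAt_iff_tendsto_slope_zero.1 (hx k hk2)).comp hz0)
  have key := hasDerivAt_integral_of_dominated_loc_of_deriv_le (μ := ν) (F := f)
    (F' := fun z x => deriv (fun k => f k x) z) (x₀ := k) (bound := fun x => bound x / (r / 4))
    (Metric.ball_mem_nhds k (by linarith : 0 < r / 2)) (hev.mono hmeas) ?_ hmeas' ?_
    (hInt.div_const _) hd
  · exact key.2.differentiableAt.differentiableWithinAt
  · exact hInt.mono' (hmeas k hk) (by filter_upwards [hbound] with x hx using hx k hk)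
  · filter_upwards [hdiff, hbound] with x hx hb z hz
    -- Cauchy's estimate on discs of radius $r/4$, which stay inside $U$ for centres in the ball of
    -- radius $r/2$.
    apply Complex.norm_deriv_le_of_forall_mem_sphere_norm_le (by linarith)
    · apply DifferentiableOn.diffContOnCl
      rw [closure_ball _ (by positivity)]
      exact hx.mono (hsub2 z hz)
    · intro w hw
      exact hb w (hsub2 z hz (Metric.sphere_subset_closedBall hw))

variable (M : ℝ → ℝ → ℂ → E →L[ℂ] E) (e : E)

/-- The Picard iterates of the Volterra equation `u(x) = e + ∫₀^∞ M(x, s) u(x + s) ds`. -/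
def volterraTerm : ℕ → ℝ → ℂ → E
  | 0, _, _ => e
  | n + 1, x, k => ∫ s in Ioi (0 : ℝ), M x s k (volterraTerm n (x + s) k)

/-- The solution of `u(x) = e + ∫₀^∞ M(x, s) u(x + s) ds` as the sum of the Picard iterates. -/
def volterraSum (x : ℝ) (k : ℂ) : E := ∑' n, volterraTerm M e n x k

/-- `M` is jointly continuous for `k ∈ D` and bounded by `C e^{-(x+s)/2}` for `x > x₀`. -/
structure IsVolterraKernel (M : ℝ → ℝ → ℂ → E →L[ℂ] E) (D : Set ℂ) (x₀ C : ℝ) : Prop where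
  continuousOn : ContinuousOn (fun p : (ℝ × ℂ) × ℝ => M p.1.1 p.2 p.1.2) {p | p.1.2 ∈ D}
  norm_le : ∀ x, x₀ < x → ∀ s, 0 < s → ∀ k ∈ D, ‖M x s k‖ ≤ C * Real.exp (-(x + s) / 2)

variable {M e} {D U : Set ℂ} {x₀ C : ℝ}

theorem integrableOn_exp_neg_add_half (x a : ℝ) (ha : 0 < a) :
    IntegrableOn (fun s => Real.exp (-a * (x + s) / 2)) (Ioi 0) := by
  have := (integrableOn_exp_mul_Ioi (a := -a / 2) (by linarith) 0).const_mul (Real.exp (-a * x / 2))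
  refine this.congr (Eventually.of_forall fun s => ?_)
  simp only [← Real.exp_add]
  ring_nf

theorem integral_exp_neg_add_half (x a : ℝ) (ha : 0 < a) :
    ∫ s in Ioi (0 : ℝ), Real.exp (-a * (x + s) / 2) = 2 / a * Real.exp (-a * x / 2) := by
  have h : ∀ s, Real.exp (-a * (x + s) / 2) = Real.exp (-a * x / 2) * Real.exp (-a / 2 * s) := by
    intro s; rw [← Real.exp_add]; ring_nf
  simp_rw [h]
  rw [integral_const_mul, integral_exp_mul_Ioi (by linarith)]
  simp
  field_simp

theorem IsVolterraKernel.continuousOn_apply (hM : IsVolterraKernel M D x₀ C) {u : ℝ → ℂ → E}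
    (hu : ContinuousOn (fun p : ℝ × ℂ => u p.1 p.2) (Ioi x₀ ×ˢ D)) :
    ContinuousOn (fun p : (ℝ × ℂ) × ℝ => M p.1.1 p.2 p.1.2 (u (p.1.1 + p.2) p.1.2))
      ((Ioi x₀ ×ˢ D) ×ˢ Ioi 0) := by
  refine (hM.continuousOn.mono fun p hp => hp.1.2).clm_apply ?_
  refine hu.comp (f := fun p : (ℝ × ℂ) × ℝ => (p.1.1 + p.2, p.1.2))
    (by fun_prop) fun p hp => ⟨?_, hp.1.2⟩
  have h1 := hp.1.1
  have h2 := hp.2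
  simp only [mem_Ioi] at h1 h2 ⊢
  linarith

theorem IsVolterraKernel.aestronglyMeasurable (hM : IsVolterraKernel M D x₀ C) {u : ℝ → ℂ → E}
    (hu : ContinuousOn (fun p : ℝ × ℂ => u p.1 p.2) (Ioi x₀ ×ˢ D)) {x : ℝ} (hx : x₀ < x) {k : ℂ}
    (hk : k ∈ D) :
    AEStronglyMeasurable (fun s => M x s k (u (x + s) k)) (volume.restrict (Ioi 0)) := by
  refine ContinuousOn.aestronglyMeasurable ?_ measurableSet_Ioi
  exact (hM.continuousOn_apply hu).comp (f := fun s : ℝ => ((x, k), s)) (by fun_prop)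
    fun s hs => ⟨⟨hx, hk⟩, hs⟩

theorem IsVolterraKernel.norm_apply_le (hM : IsVolterraKernel M D x₀ C) {x s B : ℝ} (hx : x₀ < x)
    (hs : 0 < s) {k : ℂ} (hk : k ∈ D) {z : E} (hz : ‖z‖ ≤ B) :
    ‖M x s k z‖ ≤ C * Real.exp (-(x + s) / 2) * B :=
  ((M x s k).le_opNorm z).trans
    (mul_le_mul (hM.norm_le x hx s hs k hk) hz (norm_nonneg _)
      ((norm_nonneg _).trans (hM.norm_le x hx s hs k hk)))

theorem IsVolterraKernel.continuousOn_integral (hM : IsVolterraKernel M D x₀ C) (hC : 0 ≤ C)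
    {u : ℝ → ℂ → E} (hu : ContinuousOn (fun p : ℝ × ℂ => u p.1 p.2) (Ioi x₀ ×ˢ D)) {B : ℝ}
    (hB : ∀ x, x₀ < x → ∀ k ∈ D, ‖u x k‖ ≤ B) :
    ContinuousOn (fun p : ℝ × ℂ => ∫ s in Ioi (0 : ℝ), M p.1 s p.2 (u (p.1 + s) p.2))
      (Ioi x₀ ×ˢ D) := by
  refine continuousOn_of_dominated (bound := fun s => C * Real.exp (-1 * (x₀ + s) / 2) * |B|)
    (fun p hp => hM.aestronglyMeasurable hu hp.1 hp.2) (fun p hp => ?_)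
    (((integrableOn_exp_neg_add_half x₀ 1 one_pos).const_mul C).mul_const _) ?_
  · filter_upwards [ae_restrict_mem measurableSet_Ioi] with s hs
    have hp1 : x₀ < p.1 := hp.1
    have hs' : 0 < s := hs
    refine (hM.norm_apply_le hp1 hs' hp.2 ((hB (p.1 + s) (by linarith) p.2 hp.2).trans
      (le_abs_self B))).trans ?_
    gcongr
    linarith
  · filter_upwards [ae_restrict_mem measurableSet_Ioi] with s hs
    exact (hM.continuousOn_apply hu).comp (f := fun p : ℝ × ℂ => (p, s)) (by fun_prop)
      fun p hp => ⟨hp, hs⟩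

/-- Integrating $e^{-(n+1)(x+s)/2}$ over $s>0$ produces the factor $2/(n+1)$, which builds up the
factorial. Bound and continuity go through one induction since continuity of the next iterate is
obtained by dominated convergence. -/
theorem IsVolterraKernel.norm_term_le_and_continuousOn (hM : IsVolterraKernel M D x₀ C)
    (hC : 0 ≤ C) (e : E) (n : ℕ) :
    ContinuousOn (fun p : ℝ × ℂ => volterraTerm M e n p.1 p.2) (Ioi x₀ ×ˢ D) ∧
    ∀ x, x₀ < x → ∀ k ∈ D,
      ‖volterraTerm M e n x k‖ ≤ (2 * C * Real.exp (-x / 2)) ^ n / n.factorial * ‖e‖ := by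
  induction n with
  | zero => exact ⟨continuousOn_const, fun x _ k _ => by simp [volterraTerm]⟩
  | succ n ih =>
    obtain ⟨hc, hb⟩ := ih
    refine ⟨hM.continuousOn_integral hC hc
      (B := (2 * C * Real.exp (-x₀ / 2)) ^ n / n.factorial * ‖e‖) fun x hx k hk => ?_, ?_⟩
    · refine (hb x hx k hk).trans ?_
      gcongr
    · intro x hx k hk
      have hn : (0 : ℝ) < (n + 1 : ℕ) := by positivity
      have heq : ∀ s, C * Real.exp (-(x + s) / 2) *
          ((2 * C * Real.exp (-(x + s) / 2)) ^ n / n.factorial * ‖e‖) =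
          (C * (2 * C) ^ n / n.factorial * ‖e‖) * Real.exp (-((n + 1 : ℕ) : ℝ) * (x + s) / 2) := by
        intro s
        rw [mul_pow, ← Real.exp_nat_mul]
        have : Real.exp (-((n + 1 : ℕ) : ℝ) * (x + s) / 2) =
            Real.exp (-(x + s) / 2) * Real.exp (n * (-(x + s) / 2)) := by
          rw [← Real.exp_add]; push_cast; ring_nf
        rw [this]; ring
      have hle : ‖volterraTerm M e (n + 1) x k‖ ≤ ∫ s in Ioi (0 : ℝ),
          (C * (2 * C) ^ n / n.factorial * ‖e‖) * Real.exp (-((n + 1 : ℕ) : ℝ) * (x + s) / 2) := by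
        refine norm_integral_le_of_norm_le
          ((integrableOn_exp_neg_add_half x _ hn).const_mul _) ?_
        filter_upwards [ae_restrict_mem measurableSet_Ioi] with s hs
        have hs' : 0 < s := hs
        rw [← heq]
        exact hM.norm_apply_le hx hs' hk (hb (x + s) (by linarith) k hk)
      refine hle.trans (le_of_eq ?_)
      rw [integral_const_mul, integral_exp_neg_add_half x _ hn, mul_pow _ (Real.exp _),
        ← Real.exp_nat_mul, Nat.factorial_succ]
      have : Real.exp (-((n + 1 : ℕ) : ℝ) * x / 2) = Real.exp (((n + 1 : ℕ) : ℝ) * (-x / 2)) := by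
        ring_nf
      rw [this]
      push_cast
      field_simp
      ring

theorem IsVolterraKernel.continuousOn_term (hM : IsVolterraKernel M D x₀ C) (hC : 0 ≤ C) (n : ℕ) :
    ContinuousOn (fun p : ℝ × ℂ => volterraTerm M e n p.1 p.2) (Ioi x₀ ×ˢ D) :=
  (hM.norm_term_le_and_continuousOn hC e n).1

theorem IsVolterraKernel.norm_term_le (hM : IsVolterraKernel M D x₀ C) (hC : 0 ≤ C) (n : ℕ)
    {x : ℝ} (hx : x₀ < x) {k : ℂ} (hk : k ∈ D) :
    ‖volterraTerm M e n x k‖ ≤ (2 * C * Real.exp (-x₀ / 2)) ^ n / n.factorial * ‖e‖ := by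
  refine ((hM.norm_term_le_and_continuousOn hC e n).2 x hx k hk).trans ?_
  gcongr

theorem summable_pow_div_factorial_mul (a b : ℝ) :
    Summable fun n : ℕ => a ^ n / n.factorial * b :=
  (Real.summable_pow_div_factorial a).mul_right b

theorem IsVolterraKernel.norm_sum_le (hM : IsVolterraKernel M D x₀ C) (hC : 0 ≤ C) {x : ℝ}
    (hx : x₀ < x) {k : ℂ} (hk : k ∈ D) :
    ‖volterraSum M e x k‖ ≤ ∑' n : ℕ, (2 * C * Real.exp (-x₀ / 2)) ^ n / n.factorial * ‖e‖ :=
  tsum_of_norm_bounded (summable_pow_div_factorial_mul _ _).hasSum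
    fun n => hM.norm_term_le hC n hx hk

variable [CompleteSpace E]

theorem IsVolterraKernel.differentiableOn_term (hM : IsVolterraKernel M D x₀ C) (hC : 0 ≤ C)
    (hU : IsOpen U) (hUD : U ⊆ D) (hd : ∀ x s, DifferentiableOn ℂ (M x s) U) (n : ℕ) :
    ∀ x, x₀ < x → DifferentiableOn ℂ (fun k => volterraTerm M e n x k) U := by
  induction n with
  | zero => exact fun x _ => differentiableOn_const _
  | succ n ih =>
    intro x hx
    refine differentiableOn_integral_of_dominated hU
      (bound := fun s => C * Real.exp (-1 * (x + s) / 2) *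
        ((2 * C * Real.exp (-x₀ / 2)) ^ n / n.factorial * ‖e‖))
      (fun k hk => hM.aestronglyMeasurable (hM.continuousOn_term hC n) hx (hUD hk)) ?_ ?_
      (((integrableOn_exp_neg_add_half x 1 one_pos).const_mul C).mul_const _)
    · filter_upwards [ae_restrict_mem measurableSet_Ioi] with s hs
      have hs' : 0 < s := hs
      exact (hd x s).clm_apply (ih (x + s) (by linarith))
    · filter_upwards [ae_restrict_mem measurableSet_Ioi] with s hs k hk
      have hs' : 0 < s := hs
      rw [neg_one_mul]
      exact hM.norm_apply_le hx hs' (hUD hk) (hM.norm_term_le hC n (by linarith) (hUD hk))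

theorem IsVolterraKernel.continuousOn_sum (hM : IsVolterraKernel M D x₀ C) (hC : 0 ≤ C) :
    ContinuousOn (fun p : ℝ × ℂ => volterraSum M e p.1 p.2) (Ioi x₀ ×ˢ D) :=
  continuousOn_tsum (fun n => hM.continuousOn_term hC n) (summable_pow_div_factorial_mul _ _)
    fun n _ hp => hM.norm_term_le hC n hp.1 hp.2

theorem IsVolterraKernel.differentiableOn_sum (hM : IsVolterraKernel M D x₀ C) (hC : 0 ≤ C)
    (hU : IsOpen U) (hUD : U ⊆ D) (hd : ∀ x s, DifferentiableOn ℂ (M x s) U) {x : ℝ}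
    (hx : x₀ < x) : DifferentiableOn ℂ (fun k => volterraSum M e x k) U :=
  Complex.differentiableOn_tsum_of_summable_norm (summable_pow_div_factorial_mul _ _)
    (fun n => hM.differentiableOn_term hC hU hUD hd n x hx) hU
    fun n _ hk => hM.norm_term_le hC n hx (hUD hk)

theorem IsVolterraKernel.sum_eq (hM : IsVolterraKernel M D x₀ C) (hC : 0 ≤ C) {x : ℝ}
    (hx : x₀ < x) {k : ℂ} (hk : k ∈ D) :
    volterraSum M e x k = e + ∫ s in Ioi (0 : ℝ), M x s k (volterraSum M e (x + s) k) := by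
  have hsum : ∀ y, x₀ < y → Summable fun n => volterraTerm M e n y k := fun y hy =>
    Summable.of_norm_bounded (summable_pow_div_factorial_mul _ _)
      fun n => hM.norm_term_le hC n hy hk
  have h := hasSum_integral_of_dominated_convergence (μ := volume.restrict (Ioi (0 : ℝ)))
    (F := fun n s => M x s k (volterraTerm M e n (x + s) k))
    (f := fun s => M x s k (volterraSum M e (x + s) k))
    (fun n s => C * Real.exp (-1 * (x + s) / 2) *
        ((2 * C * Real.exp (-x₀ / 2)) ^ n / n.factorial * ‖e‖))
    (fun n => hM.aestronglyMeasurable (hM.continuousOn_term hC n) hx hk) (fun n => ?_)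
    (Eventually.of_forall fun s => (summable_pow_div_factorial_mul _ _).mul_left _) ?_ ?_
  · rw [volterraSum, (hsum x hx).tsum_eq_zero_add]
    congr 1
    exact h.tsum_eq
  · filter_upwards [ae_restrict_mem measurableSet_Ioi] with s hs
    have hs' : 0 < s := hs
    rw [neg_one_mul]
    exact hM.norm_apply_le hx hs' hk (hM.norm_term_le hC n (by linarith) hk)
  · simp_rw [tsum_mul_left]
    exact ((integrableOn_exp_neg_add_half x 1 one_pos).const_mul C).mul_const _
  · filter_upwards [ae_restrict_mem measurableSet_Ioi] with s hs
    have hs' : 0 < s := hs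
    exact (M x s k).hasSum (hsum (x + s) (by linarith)).hasSum

theorem IsVolterraKernel.integrableOn_sum (hM : IsVolterraKernel M D x₀ C) (hC : 0 ≤ C) {x : ℝ}
    (hx : x₀ < x) {k : ℂ} (hk : k ∈ D) :
    IntegrableOn (fun s => M x s k (volterraSum M e (x + s) k)) (Ioi 0) := by
  refine Integrable.mono' (((integrableOn_exp_neg_add_half x 1 one_pos).const_mul C).mul_const
    (∑' n : ℕ, (2 * C * Real.exp (-x₀ / 2)) ^ n / n.factorial * ‖e‖))
    (hM.aestronglyMeasurable (hM.continuousOn_sum hC) hx hk) ?_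
  filter_upwards [ae_restrict_mem measurableSet_Ioi] with s hs
  have hs' : 0 < s := hs
  rw [neg_one_mul]
  exact hM.norm_apply_le hx hs' hk (hM.norm_sum_le hC (by linarith) hk)

/-- Inserting the uniform bound $S$ of the sum into the equation itself gains the decay of the
kernel. -/
theorem IsVolterraKernel.norm_sum_sub_le (hM : IsVolterraKernel M D x₀ C) (hC : 0 ≤ C) :
    ∃ B : ℝ, ∀ x, x₀ < x → ∀ k ∈ D, ‖volterraSum M e x k - e‖ ≤ B * Real.exp (-x / 2) := by
  set S := ∑' n : ℕ, (2 * C * Real.exp (-x₀ / 2)) ^ n / n.factorial * ‖e‖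
  refine ⟨2 * C * S, fun x hx k hk => ?_⟩
  rw [hM.sum_eq hC hx hk, add_sub_cancel_left]
  have := norm_integral_le_of_norm_le (μ := volume.restrict (Ioi (0 : ℝ)))
    (f := fun s => M x s k (volterraSum M e (x + s) k))
    (((integrableOn_exp_neg_add_half x 1 one_pos).const_mul C).mul_const S) ?_
  · refine this.trans (le_of_eq ?_)
    rw [integral_mul_const, integral_const_mul, integral_exp_neg_add_half x 1 one_pos]
    ring_nf
  · filter_upwards [ae_restrict_mem measurableSet_Ioi] with s hs
    have hs' : 0 < s := hs
    rw [neg_one_mul]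
    exact hM.norm_apply_le hx hs' hk (hM.norm_sum_le hC (by linarith) hk)

end Volterra

theorem integral_Ioi_comp_add {E : Type*} [NormedAddCommGroup E] [NormedSpace ℝ E]
    (f : ℝ → E) (x : ℝ) :
    ∫ s in Ioi (0 : ℝ), f (x + s) = ∫ t in Ioi x, f t := by
  have := (measurePreserving_add_left volume x).setIntegral_preimage_emb
    (measurableEmbedding_addLeft x) f (Ioi x)
  simpa using this

theorem integrableOn_Ioi_comp_add {E : Type*} [NormedAddCommGroup E]
    {f : ℝ → E} {x : ℝ} (h : IntegrableOn (fun s => f (x + s)) (Ioi 0)) :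
    IntegrableOn f (Ioi x) := by
  have := (measurePreserving_add_left volume x).integrableOn_comp_preimage
    (measurableEmbedding_addLeft x) (f := f) (s := Ioi x)
  rw [← this]
  simpa [Function.comp_def] using h

/-- The derivative of a tail integral. -/
theorem hasDerivAt_integral_Ioi {E : Type*} [NormedAddCommGroup E] [NormedSpace ℝ E]
    [CompleteSpace E] {f : ℝ → E} {c : ℝ} (hf : ContinuousOn f (Ioi c))
    (hi : ∀ y, c < y → IntegrableOn f (Ioi y)) {x : ℝ} (hx : c < x) :
    HasDerivAt (fun y => ∫ t in Ioi y, f t) (-f x) x := by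
  obtain ⟨y₀, hy₀, hy₀x⟩ := exists_between hx
  have heq : (fun y => ∫ t in Ioi y, f t) =ᶠ[𝓝 x]
      fun y => (∫ t in Ioi y₀, f t) - ∫ t in y₀..y, f t := by
    filter_upwards [lt_mem_nhds hy₀x] with y hy
    rw [← intervalIntegral.integral_Ioi_sub_Ioi' (hi y₀ hy₀) (hi y (hy₀.trans hy))]
    abel
  refine HasDerivAt.congr_of_eventuallyEq ?_ heq
  have hii : IntervalIntegrable f volume y₀ x := by
    apply ContinuousOn.intervalIntegrable
    rw [uIcc_of_le hy₀x.le]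
    exact hf.mono fun t ht => hy₀.trans_le ht.1
  exact (intervalIntegral.integral_hasDerivAt_right hii
    (hf.stronglyMeasurableAtFilter isOpen_Ioi x hx)
    (hf.continuousAt (Ioi_mem_nhds hx))).const_sub _

end VolterraEquation

/-! ### Solutions of the radial equation: initial values, Wronskians, fundamental systems -/

section RadialEquation

theorem tendsto_const_mul_exp_neg_half (B : ℝ) :
    Tendsto (fun x : ℝ => B * Real.exp (-x / 2)) atTop (𝓝 0) := by
  have : Tendsto (fun x : ℝ => -x / 2) atTop atBot :=
    (tendsto_neg_atTop_atBot).atBot_div_const (by norm_num)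
  simpa using (Real.tendsto_exp_atBot.comp this).const_mul B

/-- Solutions of the linear system `V' = A(x) V` on `(0, ∞)` with prescribed value at `0`. -/
theorem exists_linear_system_solution {E : Type*} [NormedAddCommGroup E] [NormedSpace ℂ E]
    [CompleteSpace E] {A : ℝ → E →L[ℂ] E} (hA : Continuous A) (e : E) :
    ∃ V : ℝ → E, (∀ x, 0 < x → HasDerivAt V (A x (V x)) x) ∧ Tendsto V (𝓝[>] 0) (𝓝 e) := by
  -- The substitution $\xi=e^{-x/2}$ moves the initial point $0$ to $x=\infty$ and turns
  -- $V(\xi)=e+\int_0^\xi AV$ into a Volterra equation on a half-line. The factor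
  -- $\frac12e^{-(x+s)/2}$ is the Jacobian, and the complex parameter is a dummy.
  let M : ℝ → ℝ → ℂ → E →L[ℂ] E := fun x s _ =>
    ((1 / 2 * Real.exp (-(x + s) / 2) : ℝ) : ℂ) • A (Real.exp (-(x + s) / 2))
  have hker : ∀ x₀ : ℝ, ∃ C : ℝ, 0 ≤ C ∧ IsVolterraKernel M univ x₀ C := by
    intro x₀
    obtain ⟨C, hC⟩ := (isCompact_Icc (a := (0 : ℝ))
      (b := Real.exp (-x₀ / 2))).exists_bound_of_continuousOn hA.continuousOn
    refine ⟨|C|, abs_nonneg _, ⟨?_, ?_⟩⟩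
    · apply Continuous.continuousOn
      dsimp only [M]
      fun_prop
    · intro x hx s hs k _
      dsimp only [M]
      rw [norm_smul, Complex.norm_real, Real.norm_of_nonneg (by positivity)]
      have h1 : ‖A (Real.exp (-(x + s) / 2))‖ ≤ |C| :=
        (hC _ ⟨(Real.exp_pos _).le, Real.exp_le_exp.2 (by linarith)⟩).trans (le_abs_self C)
      have h2 := Real.exp_pos (-(x + s) / 2)
      nlinarith [norm_nonneg (A (Real.exp (-(x + s) / 2))), mul_le_mul_of_nonneg_left h1 h2.le]
  let u : ℝ → E := fun x => volterraSum M e x 0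
  have hucont : Continuous u := by
    rw [continuous_iff_continuousAt]
    intro x
    obtain ⟨C, hC, hM⟩ := hker (x - 1)
    have h := (hM.continuousOn_sum (e := e) hC).comp (f := fun y : ℝ => (y, (0 : ℂ)))
      (s := Ioi (x - 1)) (by fun_prop) fun y hy => ⟨hy, mem_univ _⟩
    exact h.continuousAt (Ioi_mem_nhds (by linarith))
  let h : ℝ → E := fun t => ((1 / 2 * Real.exp (-t / 2) : ℝ) : ℂ) • A (Real.exp (-t / 2)) (u t)
  have hhcont : Continuous h := by
    dsimp only [h]
    have : Continuous fun t => A (Real.exp (-t / 2)) := by fun_prop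
    exact Continuous.smul (by fun_prop) (this.clm_apply hucont)
  have hInt : ∀ x, IntegrableOn h (Ioi x) := by
    intro x
    obtain ⟨C, hC, hM⟩ := hker (x - 1)
    exact integrableOn_Ioi_comp_add (hM.integrableOn_sum hC (by linarith) (mem_univ 0))
  have hu : ∀ x, u x = e + ∫ t in Ioi x, h t := by
    intro x
    obtain ⟨C, hC, hM⟩ := hker (x - 1)
    rw [← integral_Ioi_comp_add h]
    exact hM.sum_eq hC (by linarith) (mem_univ 0)
  have hud : ∀ x, HasDerivAt u (-h x) x := by
    intro x
    have := (hasDerivAt_integral_Ioi (c := x - 1) hhcont.continuousOn (fun y _ => hInt y)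
      (x := x) (by linarith)).const_add e
    exact this.congr_of_eventuallyEq (Eventually.of_forall hu)
  have hexp : ∀ x : ℝ, 0 < x → Real.exp (-(-2 * Real.log x) / 2) = x := by
    intro x hx
    rw [show -(-2 * Real.log x) / 2 = Real.log x by ring, Real.exp_log hx]
  refine ⟨fun x => u (-2 * Real.log x), fun x hx => ?_, ?_⟩
  · have h1 := (hud (-2 * Real.log x)).scomp x ((Real.hasDerivAt_log hx.ne').const_mul (-2))
    refine h1.congr_deriv ?_
    dsimp only [h]
    rw [hexp x hx, smul_neg, ← neg_smul, ← Complex.coe_smul, smul_smul]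
    have : ((-(-2 * x⁻¹) : ℝ) : ℂ) * ((1 / 2 * x : ℝ) : ℂ) = 1 := by
      have hx' : (x : ℂ) ≠ 0 := by exact_mod_cast hx.ne'
      push_cast
      field_simp
    rw [this, one_smul]
  · obtain ⟨C, hC, hM⟩ := hker 0
    obtain ⟨B, hB⟩ := hM.norm_sum_sub_le (e := e) hC
    have htop : Tendsto (fun x => -2 * Real.log x) (𝓝[>] 0) atTop :=
      Real.tendsto_log_nhdsGT_zero.const_mul_atBot_of_neg (by norm_num)
    suffices hsuff : Tendsto u atTop (𝓝 e) from hsuff.comp htop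
    rw [tendsto_iff_norm_sub_tendsto_zero]
    refine squeeze_zero' (Eventually.of_forall fun _ => norm_nonneg _) ?_
      (tendsto_const_mul_exp_neg_half B)
    filter_upwards [eventually_gt_atTop 0] with x hx
    exact hB x hx 0 (mem_univ 0)

/-- `v` solves the radial equation on `ξ > 0` and `v'` is its derivative. -/
def IsRadialPair (Z : ℝ) (μ k : ℂ) (v v' : ℝ → ℂ) : Prop :=
  ∀ ξ : ℝ, 0 < ξ → HasDerivAt v (v' ξ) ξ ∧
    HasDerivAt v' (-((k ^ 2 * (Real.cosh ξ : ℂ) ^ 2 + (Z : ℂ) * (Real.cosh ξ : ℂ) - μ) * v ξ)) ξ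

variable {Z : ℝ} {μ k : ℂ} {v v' w w' : ℝ → ℂ}

theorem IsRadialPair.const_mul (h : IsRadialPair Z μ k v v') (c : ℂ) :
    IsRadialPair Z μ k (fun ξ => c * v ξ) (fun ξ => c * v' ξ) := fun ξ hξ =>
  ⟨(h ξ hξ).1.const_mul c, ((h ξ hξ).2.const_mul c).congr_deriv (by ring)⟩

theorem IsRadialPair.sub (h : IsRadialPair Z μ k v v') (h₁ : IsRadialPair Z μ k w w') :
    IsRadialPair Z μ k (fun ξ => v ξ - w ξ) (fun ξ => v' ξ - w' ξ) := fun ξ hξ =>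
  ⟨(h ξ hξ).1.sub (h₁ ξ hξ).1, ((h ξ hξ).2.sub (h₁ ξ hξ).2).congr_deriv (by ring)⟩

theorem IsRadialPair.exists_wronskian_eq (h : IsRadialPair Z μ k v v')
    (h₁ : IsRadialPair Z μ k w w') :
    ∃ c : ℂ, ∀ ξ, 0 < ξ → v ξ * w' ξ - v' ξ * w ξ = c := by
  have hd : ∀ ξ ∈ Ioi (0 : ℝ), HasDerivAt (fun ξ => v ξ * w' ξ - v' ξ * w ξ) 0 ξ := by
    intro ξ hξ
    refine (((h ξ hξ).1.mul (h₁ ξ hξ).2).sub ((h ξ hξ).2.mul (h₁ ξ hξ).1)).congr_deriv ?_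
    ring
  obtain ⟨c, hc⟩ := isOpen_Ioi.exists_is_const_of_deriv_eq_zero isPreconnected_Ioi
    (fun ξ hξ => (hd ξ hξ).differentiableAt.differentiableWithinAt) (fun ξ hξ => (hd ξ hξ).deriv)
  exact ⟨c, fun ξ hξ => hc ξ hξ⟩

/-- Solutions of the radial equation with prescribed values at `0`. -/
theorem exists_isRadialPair (Z : ℝ) (μ k : ℂ) (e : ℂ × ℂ) :
    ∃ v v' : ℝ → ℂ, IsRadialPair Z μ k v v' ∧ Tendsto v (𝓝[>] 0) (𝓝 e.1) ∧
      Tendsto v' (𝓝[>] 0) (𝓝 e.2) := by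
  let A : ℝ → (ℂ × ℂ) →L[ℂ] (ℂ × ℂ) := fun ξ =>
    (ContinuousLinearMap.inl ℂ ℂ ℂ).comp (ContinuousLinearMap.snd ℂ ℂ ℂ) -
      (k ^ 2 * (Real.cosh ξ : ℂ) ^ 2 + (Z : ℂ) * (Real.cosh ξ : ℂ) - μ) •
        (ContinuousLinearMap.inr ℂ ℂ ℂ).comp (ContinuousLinearMap.fst ℂ ℂ ℂ)
  have hA : Continuous A := by
    have : Continuous fun ξ => (Real.cosh ξ : ℂ) :=
      Complex.continuous_ofReal.comp Real.continuous_cosh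
    dsimp only [A]
    fun_prop
  obtain ⟨V, hV, h0⟩ := exists_linear_system_solution hA e
  refine ⟨fun ξ => (V ξ).1, fun ξ => (V ξ).2, fun ξ hξ => ⟨?_, ?_⟩,
    (continuous_fst.tendsto e).comp h0, (continuous_snd.tendsto e).comp h0⟩
  · refine ((ContinuousLinearMap.fst ℝ ℂ ℂ).hasFDerivAt.comp_hasDerivAt ξ
      (hV ξ hξ)).congr_deriv ?_
    simp [A]
  · refine ((ContinuousLinearMap.snd ℝ ℂ ℂ).hasFDerivAt.comp_hasDerivAt ξ
      (hV ξ hξ)).congr_deriv ?_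
    simp [A]

/-- A nontrivial solution is completed to a fundamental system with Wronskian `1`. -/
theorem IsRadialPair.exists_second_solution (h : IsRadialPair Z μ k v v') {ξ₀ : ℝ} (hξ₀ : 0 < ξ₀)
    (hv : v ξ₀ ≠ 0) :
    ∃ w w' : ℝ → ℂ, IsRadialPair Z μ k w w' ∧ ∀ ξ, 0 < ξ → v ξ * w' ξ - v' ξ * w ξ = 1 := by
  obtain ⟨f, f', hf, hf0, hf0'⟩ := exists_isRadialPair Z μ k (1, 0)
  obtain ⟨g, g', hg, hg0, hg0'⟩ := exists_isRadialPair Z μ k (0, 1)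
  obtain ⟨c, hc⟩ := hf.exists_wronskian_eq hg
  have hc1 : c = 1 := by
    have h1 : Tendsto (fun ξ => f ξ * g' ξ - f' ξ * g ξ) (𝓝[>] 0) (𝓝 (1 * 1 - 0 * 0)) :=
      (hf0.mul hg0').sub (hf0'.mul hg0)
    have h2 : Tendsto (fun ξ => f ξ * g' ξ - f' ξ * g ξ) (𝓝[>] 0) (𝓝 c) :=
      tendsto_const_nhds.congr' (by
        filter_upwards [self_mem_nhdsWithin] with ξ hξ using (hc ξ hξ).symm)
    simpa using tendsto_nhds_unique h2 h1
  subst hc1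
  obtain ⟨α, hα⟩ := h.exists_wronskian_eq hg
  obtain ⟨β, hβ⟩ := h.exists_wronskian_eq hf
  -- Since $f,g$ have Wronskian $1$, $v=\alpha f-\beta g$. So $\alpha$ and $\beta$ cannot both
  -- vanish, and rescaling $g$ or $f$ gives the partner.
  by_cases hα0 : α = 0
  · have hβ0 : β ≠ 0 := by
      rintro rfl
      apply hv
      linear_combination (-v ξ₀) * hc ξ₀ hξ₀ + f ξ₀ * (hα ξ₀ hξ₀) - g ξ₀ * (hβ ξ₀ hξ₀) +
        f ξ₀ * hα0
    refine ⟨_, _, hf.const_mul β⁻¹, fun ξ hξ => ?_⟩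
    have := hβ ξ hξ
    field_simp
    linear_combination this
  · refine ⟨_, _, hg.const_mul α⁻¹, fun ξ hξ => ?_⟩
    have := hα ξ hξ
    field_simp
    linear_combination this

end RadialEquation

/-! ### The comparison function and the first order system -/

section Comparison

/-- The explicit comparison phase `k sinh ξ + Z ξ / (2 k)`. -/
def phase (Z ξ : ℝ) (k : ℂ) : ℂ := k * (Real.sinh ξ : ℂ) + (Z : ℂ) * (ξ : ℂ) / (2 * k)

/-- The derivative of the comparison phase in `ξ`. -/
def phaseDeriv (Z ξ : ℝ) (k : ℂ) : ℂ := k * (Real.cosh ξ : ℂ) + (Z : ℂ) / (2 * k)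

/-- The comparison function `(cosh ξ)^{-1/2} exp(i ψ(ξ, k))`. -/
def comparison (Z ξ : ℝ) (k : ℂ) : ℂ :=
  (((Real.sqrt (Real.cosh ξ))⁻¹ : ℝ) : ℂ) * Complex.exp (Complex.I * phase Z ξ k)

/-- The residual `y'' / y + (k² cosh² ξ + Z cosh ξ - μ)` of the comparison function `y`. -/
def residual (Z : ℝ) (μ : ℂ) (ξ : ℝ) (k : ℂ) : ℂ :=
  ((Real.sinh ξ : ℂ) / (Real.cosh ξ : ℂ)) ^ 2 / 4 - 1 / (2 * (Real.cosh ξ : ℂ) ^ 2)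
    - Complex.I * (Z : ℂ) / (2 * k) * ((Real.sinh ξ : ℂ) / (Real.cosh ξ : ℂ))
    - (Z : ℂ) ^ 2 / (4 * k ^ 2) - μ

theorem ofReal_cosh_ne_zero (ξ : ℝ) : (Real.cosh ξ : ℂ) ≠ 0 := by
  exact_mod_cast (Real.cosh_pos ξ).ne'

theorem hasDerivAt_ofReal_cosh (ξ : ℝ) :
    HasDerivAt (fun ξ : ℝ => (Real.cosh ξ : ℂ)) (Real.sinh ξ : ℂ) ξ :=
  (Real.hasDerivAt_cosh ξ).ofReal_comp

theorem hasDerivAt_ofReal_sinh (ξ : ℝ) :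
    HasDerivAt (fun ξ : ℝ => (Real.sinh ξ : ℂ)) (Real.cosh ξ : ℂ) ξ :=
  (Real.hasDerivAt_sinh ξ).ofReal_comp

theorem ofReal_cosh_sq (ξ : ℝ) : (Real.cosh ξ : ℂ) ^ 2 = (Real.sinh ξ : ℂ) ^ 2 + 1 := by
  exact_mod_cast Real.cosh_sq ξ

theorem hasDerivAt_phase (Z ξ : ℝ) (k : ℂ) :
    HasDerivAt (fun ξ => phase Z ξ k) (phaseDeriv Z ξ k) ξ := by
  have h1 := (hasDerivAt_ofReal_sinh ξ).const_mul k
  have h2 : HasDerivAt (fun ξ : ℝ => (Z : ℂ) * (ξ : ℂ) / (2 * k)) ((Z : ℂ) / (2 * k)) ξ := by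
    simpa using ((hasDerivAt_id ξ).ofReal_comp.const_mul (Z : ℂ)).div_const (2 * k)
  exact h1.add h2

theorem hasDerivAt_phaseDeriv (Z ξ : ℝ) (k : ℂ) :
    HasDerivAt (fun ξ => phaseDeriv Z ξ k) (k * (Real.sinh ξ : ℂ)) ξ :=
  ((hasDerivAt_ofReal_cosh ξ).const_mul k).add_const _

theorem hasDerivAt_comparison (Z ξ : ℝ) (k : ℂ) :
    HasDerivAt (fun ξ => comparison Z ξ k)
      (comparison Z ξ k * (-(Real.sinh ξ : ℂ) / (2 * (Real.cosh ξ : ℂ)) +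
        Complex.I * phaseDeriv Z ξ k)) ξ := by
  have hc := Real.cosh_pos ξ
  have h1 : HasDerivAt (fun ξ => (Real.sqrt (Real.cosh ξ))⁻¹)
      ((Real.sqrt (Real.cosh ξ))⁻¹ * (-Real.sinh ξ / (2 * Real.cosh ξ))) ξ := by
    refine (((Real.hasDerivAt_cosh ξ).sqrt hc.ne').inv (Real.sqrt_pos.2 hc).ne').congr_deriv ?_
    have hs := Real.sq_sqrt hc.le
    have hs0 := (Real.sqrt_pos.2 hc).ne'
    field_simp
    rw [hs]
  have h2 := h1.ofReal_comp
  have h3 := ((hasDerivAt_phase Z ξ k).const_mul Complex.I).cexp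
  refine (h2.mul h3).congr_deriv ?_
  simp only [comparison]
  push_cast
  ring

theorem phase_neg (Z ξ : ℝ) (k : ℂ) : phase Z ξ (-k) = -phase Z ξ k := by
  simp only [phase]
  rw [mul_neg, div_neg]
  ring

/-- If `m` and `b` solve the first order system below then `y m` solves the radial equation. -/
theorem isRadialPair_comparison_mul {Z : ℝ} {μ k : ℂ} (hk : k ≠ 0) {m b : ℝ → ℂ}
    (hm : ∀ ξ, 0 < ξ → HasDerivAt m ((Real.cosh ξ : ℂ) * b ξ) ξ)
    (hb : ∀ ξ, 0 < ξ → HasDerivAt b (-2 * Complex.I * phaseDeriv Z ξ k * b ξ -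
      residual Z μ ξ k / (Real.cosh ξ : ℂ) * m ξ) ξ) :
    IsRadialPair Z μ k (fun ξ => comparison Z ξ k * m ξ)
      (fun ξ => comparison Z ξ k * ((-(Real.sinh ξ : ℂ) / (2 * (Real.cosh ξ : ℂ)) +
        Complex.I * phaseDeriv Z ξ k) * m ξ + (Real.cosh ξ : ℂ) * b ξ)) := by
  intro ξ hξ
  have hc := ofReal_cosh_ne_zero ξ
  refine ⟨((hasDerivAt_comparison Z ξ k).mul (hm ξ hξ)).congr_deriv (by ring), ?_⟩
  have h1 := ((hasDerivAt_ofReal_sinh ξ).neg.div ((hasDerivAt_ofReal_cosh ξ).const_mul 2)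
    (mul_ne_zero two_ne_zero hc)).add ((hasDerivAt_phaseDeriv Z ξ k).const_mul Complex.I)
  have h2 := (hasDerivAt_comparison Z ξ k).mul
    ((h1.mul (hm ξ hξ)).add ((hasDerivAt_ofReal_cosh ξ).mul (hb ξ hξ)))
  refine h2.congr_deriv ?_
  simp only [residual, phaseDeriv, Pi.add_apply, Pi.div_apply, Pi.neg_apply, Pi.mul_apply]
  have hs := ofReal_cosh_sq ξ
  have hI := Complex.I_sq
  -- What remains is an algebraic identity modulo $S^2=c^2-1$ and $i^2=-1$.
  generalize (Real.sinh ξ : ℂ) = S at *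
  generalize (Real.cosh ξ : ℂ) = c at *
  generalize comparison Z ξ k = y
  generalize m ξ = m₀
  generalize b ξ = b₀
  have hS : S ^ 2 = c ^ 2 - 1 := by rw [hs]; ring
  field_simp
  ring_nf
  simp only [hI, hS, pow_succ]
  ring_nf

end Comparison

/-! ### The kernel of the Volterra equation and its uniform bound -/

section Kernel

/-- Both terms of the phase contribute a multiple of $\operatorname{Im}k$, so its sign alone decides
between growth and decay for large $\xi$. -/
theorem im_phase (Z ξ : ℝ) (k : ℂ) :
    (phase Z ξ k).im = k.im * (Real.sinh ξ - Z / (2 * ‖k‖ ^ 2) * ξ) := by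
  have h1 : (Z : ℂ) * (ξ : ℂ) / (2 * k) = ((Z * ξ / 2 : ℝ) : ℂ) * k⁻¹ := by
    push_cast
    rw [div_eq_mul_inv, mul_inv]
    ring
  rw [phase, h1, Complex.add_im, Complex.im_mul_ofReal, Complex.im_ofReal_mul, Complex.inv_im,
    Complex.normSq_eq_norm_sq]
  ring

theorem sq_div_four_le_sinh {x : ℝ} (hx : 0 ≤ x) : x ^ 2 / 4 ≤ Real.sinh x := by
  rw [Real.sinh_eq]
  have h1 := Real.quadratic_le_exp_of_nonneg hx
  have h2 : Real.exp (-x) ≤ 1 := Real.exp_le_one_iff.2 (by linarith)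
  linarith

/-- The difference equals $2\cosh\frac{t+\xi}2\sinh\frac{t-\xi}2$; dropping the $\cosh$ leaves a
bound in $t-\xi$ only. -/
theorem two_mul_sinh_half_le {ξ t : ℝ} (h : ξ ≤ t) :
    2 * Real.sinh ((t - ξ) / 2) ≤ Real.sinh t - Real.sinh ξ := by
  have e1 : Real.sinh t = Real.sinh ((t + ξ) / 2 + (t - ξ) / 2) := by ring_nf
  have e2 : Real.sinh ξ = Real.sinh ((t + ξ) / 2 - (t - ξ) / 2) := by ring_nf
  rw [e1, e2, Real.sinh_add, Real.sinh_sub]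
  have h1 := Real.one_le_cosh ((t + ξ) / 2)
  have h2 : 0 ≤ Real.sinh ((t - ξ) / 2) := Real.sinh_nonneg_iff.2 (by linarith)
  nlinarith

/-- The imaginary part of the phase need not be monotone in $\xi$, but the possible loss is bounded:
with $\beta=Z/(2|k|^2)$ one completes the square in $(t-\xi)^2/8-\beta(t-\xi)\ge-2\beta^2$. -/
theorem neg_le_im_phase_sub {Z ξ t δ : ℝ} (hδ : 0 < δ) {k : ℂ} (hk : 0 ≤ k.im) (hkδ : δ ≤ ‖k‖)
    (h : ξ ≤ t) : -(Z ^ 2 / (2 * δ ^ 3)) ≤ (phase Z t k - phase Z ξ k).im := by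
  rw [Complex.sub_im, im_phase, im_phase]
  have hk0 : 0 < ‖k‖ := hδ.trans_le hkδ
  set β := Z / (2 * ‖k‖ ^ 2) with hβ
  have h1 := two_mul_sinh_half_le h
  have h2 := sq_div_four_le_sinh (x := (t - ξ) / 2) (by linarith)
  have h3 : -(2 * β ^ 2) ≤ (Real.sinh t - Real.sinh ξ) - β * (t - ξ) := by
    nlinarith [sq_nonneg ((t - ξ) / 2 - 2 * β)]
  have h4 : k.im ≤ ‖k‖ := (le_abs_self _).trans (Complex.abs_im_le_norm k)
  have h5 : k.im * (2 * β ^ 2) ≤ Z ^ 2 / (2 * δ ^ 3) := by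
    calc k.im * (2 * β ^ 2) ≤ ‖k‖ * (2 * β ^ 2) := by gcongr
      _ = Z ^ 2 / (2 * ‖k‖ ^ 3) := by rw [hβ]; field_simp
      _ ≤ Z ^ 2 / (2 * δ ^ 3) := by gcongr
  nlinarith [mul_le_mul_of_nonneg_left h3 hk]

theorem norm_exp_phase_sub_le {Z ξ t δ : ℝ} (hδ : 0 < δ) {k : ℂ} (hk : 0 ≤ k.im) (hkδ : δ ≤ ‖k‖)
    (h : ξ ≤ t) :
    ‖Complex.exp (2 * Complex.I * (phase Z t k - phase Z ξ k))‖ ≤ Real.exp (Z ^ 2 / δ ^ 3) := by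
  rw [Complex.norm_exp]
  apply Real.exp_le_exp.2
  have h1 := neg_le_im_phase_sub (Z := Z) hδ hk hkδ h
  have h2 : (2 * Complex.I * (phase Z t k - phase Z ξ k)).re =
      -2 * (phase Z t k - phase Z ξ k).im := by
    rw [mul_assoc]
    simp
    ring
  have h3 : Z ^ 2 / δ ^ 3 = 2 * (Z ^ 2 / (2 * δ ^ 3)) := by field_simp
  rw [h2, h3]
  linarith

theorem abs_sinh_div_cosh_le (ξ : ℝ) : |Real.sinh ξ / Real.cosh ξ| ≤ 1 := by
  rw [← Real.tanh_eq_sinh_div_cosh, abs_le]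
  exact ⟨(Real.neg_one_lt_tanh ξ).le, (Real.tanh_lt_one ξ).le⟩

theorem norm_residual_le (Z : ℝ) (μ : ℂ) (ξ : ℝ) {δ : ℝ} (hδ : 0 < δ) {k : ℂ} (hk : δ ≤ ‖k‖) :
    ‖residual Z μ ξ k‖ ≤ 1 / 4 + 1 / 2 + |Z| / (2 * δ) + Z ^ 2 / (4 * δ ^ 2) + ‖μ‖ := by
  have ht : ‖(Real.sinh ξ : ℂ) / (Real.cosh ξ : ℂ)‖ ≤ 1 := by
    rw [← Complex.ofReal_div, Complex.norm_real]
    exact abs_sinh_div_cosh_le ξ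
  have h1 : ‖((Real.sinh ξ : ℂ) / (Real.cosh ξ : ℂ)) ^ 2 / 4‖ ≤ 1 / 4 := by
    rw [norm_div, norm_pow]
    have : ‖(Real.sinh ξ : ℂ) / (Real.cosh ξ : ℂ)‖ ^ 2 ≤ 1 := pow_le_one₀ (norm_nonneg _) ht
    rw [Complex.norm_ofNat]
    linarith
  have h2 : ‖1 / (2 * (Real.cosh ξ : ℂ) ^ 2)‖ ≤ 1 / 2 := by
    rw [norm_div, norm_mul, norm_pow, Complex.norm_real, Real.norm_of_nonneg (Real.cosh_pos ξ).le,
      norm_one, Complex.norm_ofNat]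
    apply one_div_le_one_div_of_le (by norm_num)
    nlinarith [Real.one_le_cosh ξ]
  have h3 : ‖Complex.I * (Z : ℂ) / (2 * k) * ((Real.sinh ξ : ℂ) / (Real.cosh ξ : ℂ))‖ ≤
      |Z| / (2 * δ) := by
    rw [norm_mul, norm_div, norm_mul, norm_mul, Complex.norm_I, Complex.norm_real,
      Complex.norm_ofNat, one_mul, Real.norm_eq_abs]
    calc |Z| / (2 * ‖k‖) * ‖(Real.sinh ξ : ℂ) / (Real.cosh ξ : ℂ)‖ ≤ |Z| / (2 * δ) * 1 := by gcongr
      _ = _ := mul_one _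
  have h4 : ‖(Z : ℂ) ^ 2 / (4 * k ^ 2)‖ ≤ Z ^ 2 / (4 * δ ^ 2) := by
    rw [norm_div, norm_mul, norm_pow, norm_pow, Complex.norm_real, Complex.norm_ofNat,
      Real.norm_eq_abs, sq_abs]
    gcongr
  rw [residual]
  refine (norm_sub_le _ _).trans (add_le_add ?_ le_rfl)
  refine (norm_sub_le _ _).trans (add_le_add ?_ h4)
  refine (norm_sub_le _ _).trans (add_le_add ?_ h3)
  exact (norm_sub_le _ _).trans (add_le_add h1 h2)

/-- The kernel of the Volterra equation for the pair `(m + b / (2ik), e^{ξ/2} b)`, where `y m` is the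
solution of the radial equation and `m' = b cosh`. -/
def jostKernel (Z : ℝ) (μ : ℂ) (ξ s : ℝ) (k : ℂ) : (ℂ × ℂ) →L[ℂ] (ℂ × ℂ) :=
  (residual Z μ (ξ + s) k / (2 * Complex.I * k * (Real.cosh (ξ + s) : ℂ))) •
      (ContinuousLinearMap.inl ℂ ℂ ℂ).comp (ContinuousLinearMap.fst ℂ ℂ ℂ) +
    ((Z : ℂ) / (2 * k ^ 2) * (Real.exp (-(ξ + s) / 2) : ℂ) -
      residual Z μ (ξ + s) k / (2 * Complex.I * k * (Real.cosh (ξ + s) : ℂ)) *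
        ((Real.exp (-(ξ + s) / 2) : ℂ) / (2 * Complex.I * k))) •
      (ContinuousLinearMap.inl ℂ ℂ ℂ).comp (ContinuousLinearMap.snd ℂ ℂ ℂ) +
    ((Real.exp (ξ / 2) : ℂ) * Complex.exp (2 * Complex.I * (phase Z (ξ + s) k - phase Z ξ k)) *
      residual Z μ (ξ + s) k / (Real.cosh (ξ + s) : ℂ)) •
      (ContinuousLinearMap.inr ℂ ℂ ℂ).comp (ContinuousLinearMap.fst ℂ ℂ ℂ -
        ((Real.exp (-(ξ + s) / 2) : ℂ) / (2 * Complex.I * k)) • ContinuousLinearMap.snd ℂ ℂ ℂ)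

/-- The closed half-plane without a disc around `0`. -/
def upperDomain (δ : ℝ) : Set ℂ := {k | 0 ≤ k.im ∧ δ ≤ ‖k‖}

theorem ne_zero_of_mem_upperDomain {δ : ℝ} (hδ : 0 < δ) {k : ℂ} (hk : k ∈ upperDomain δ) :
    k ≠ 0 := norm_pos_iff.1 (hδ.trans_le hk.2)

/-- This form exhibits $m$, which is recovered from the pair as $z_1-\frac{e^{-t/2}}{2ik}z_2$ with
$t=\xi+s$. -/
theorem jostKernel_apply (Z : ℝ) (μ : ℂ) (ξ s : ℝ) (k : ℂ) (z : ℂ × ℂ) :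
    jostKernel Z μ ξ s k z =
      (residual Z μ (ξ + s) k / (2 * Complex.I * k * (Real.cosh (ξ + s) : ℂ)) *
          (z.1 - (Real.exp (-(ξ + s) / 2) : ℂ) / (2 * Complex.I * k) * z.2) +
        (Z : ℂ) / (2 * k ^ 2) * (Real.exp (-(ξ + s) / 2) : ℂ) * z.2,
       (Real.exp (ξ / 2) : ℂ) * Complex.exp (2 * Complex.I * (phase Z (ξ + s) k - phase Z ξ k)) *
        residual Z μ (ξ + s) k / (Real.cosh (ξ + s) : ℂ) *
          (z.1 - (Real.exp (-(ξ + s) / 2) : ℂ) / (2 * Complex.I * k) * z.2)) := by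
  ext
  · simp [jostKernel]
    ring
  · simp [jostKernel]

theorem continuous_ofReal_cosh : Continuous fun ξ : ℝ => (Real.cosh ξ : ℂ) :=
  Complex.continuous_ofReal.comp Real.continuous_cosh

theorem continuous_ofReal_sinh : Continuous fun ξ : ℝ => (Real.sinh ξ : ℂ) :=
  Complex.continuous_ofReal.comp Real.continuous_sinh

theorem continuousAt_phase (Z : ℝ) {p : ℝ × ℂ} (hk : p.2 ≠ 0) :
    ContinuousAt (fun p : ℝ × ℂ => phase Z p.1 p.2) p := by
  have h1 : ContinuousAt (fun p : ℝ × ℂ => (Real.sinh p.1 : ℂ)) p :=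
    (continuous_ofReal_sinh.comp continuous_fst).continuousAt
  have h2 : 2 * p.2 ≠ 0 := mul_ne_zero two_ne_zero hk
  unfold phase
  fun_prop (disch := assumption)

theorem continuousAt_residual (Z : ℝ) (μ : ℂ) {p : ℝ × ℂ} (hk : p.2 ≠ 0) :
    ContinuousAt (fun p : ℝ × ℂ => residual Z μ p.1 p.2) p := by
  have h1 : ContinuousAt (fun p : ℝ × ℂ => (Real.sinh p.1 : ℂ)) p :=
    (continuous_ofReal_sinh.comp continuous_fst).continuousAt
  have h1' : ContinuousAt (fun p : ℝ × ℂ => (Real.cosh p.1 : ℂ)) p :=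
    (continuous_ofReal_cosh.comp continuous_fst).continuousAt
  have h2 : 2 * p.2 ≠ 0 := mul_ne_zero two_ne_zero hk
  have h3 : 4 * p.2 ^ 2 ≠ 0 := mul_ne_zero (by norm_num) (pow_ne_zero _ hk)
  have h4 := ofReal_cosh_ne_zero p.1
  have h5 : 2 * (Real.cosh p.1 : ℂ) ^ 2 ≠ 0 := mul_ne_zero two_ne_zero (pow_ne_zero _ h4)
  unfold residual
  fun_prop (disch := assumption)

theorem continuousAt_jostKernel (Z : ℝ) (μ : ℂ) {p : (ℝ × ℂ) × ℝ} (hk : p.1.2 ≠ 0) :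
    ContinuousAt (fun p : (ℝ × ℂ) × ℝ => jostKernel Z μ p.1.1 p.2 p.1.2) p := by
  have h1 : ContinuousAt (fun p : (ℝ × ℂ) × ℝ => phase Z p.1.1 p.1.2) p :=
    (continuousAt_phase Z (p := p.1) hk).comp continuousAt_fst
  have h2 : ContinuousAt (fun p : (ℝ × ℂ) × ℝ => phase Z (p.1.1 + p.2) p.1.2) p :=
    ContinuousAt.comp (f := fun p : (ℝ × ℂ) × ℝ => (p.1.1 + p.2, p.1.2))
      (continuousAt_phase Z (p := (p.1.1 + p.2, p.1.2)) hk) (by fun_prop)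
  have h3 : ContinuousAt (fun p : (ℝ × ℂ) × ℝ => residual Z μ (p.1.1 + p.2) p.1.2) p :=
    ContinuousAt.comp (f := fun p : (ℝ × ℂ) × ℝ => (p.1.1 + p.2, p.1.2))
      (continuousAt_residual Z μ (p := (p.1.1 + p.2, p.1.2)) hk) (by fun_prop)
  have h4 : ContinuousAt (fun p : (ℝ × ℂ) × ℝ => (Real.cosh (p.1.1 + p.2) : ℂ)) p :=
    (continuous_ofReal_cosh.comp (by fun_prop)).continuousAt
  have h5 := ofReal_cosh_ne_zero (p.1.1 + p.2)
  have h6 : 2 * Complex.I * p.1.2 ≠ 0 :=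
    mul_ne_zero (mul_ne_zero two_ne_zero Complex.I_ne_zero) hk
  have h7 : 2 * Complex.I * p.1.2 * (Real.cosh (p.1.1 + p.2) : ℂ) ≠ 0 := mul_ne_zero h6 h5
  have h8 : 2 * p.1.2 ^ 2 ≠ 0 := mul_ne_zero two_ne_zero (pow_ne_zero _ hk)
  unfold jostKernel
  fun_prop (disch := assumption)

theorem differentiableAt_jostKernel (Z : ℝ) (μ : ℂ) (ξ s : ℝ) {k : ℂ} (hk : k ≠ 0) :
    DifferentiableAt ℂ (jostKernel Z μ ξ s) k := by
  have h2 : 2 * k ≠ 0 := mul_ne_zero two_ne_zero hk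
  have h3 : 4 * k ^ 2 ≠ 0 := mul_ne_zero (by norm_num) (pow_ne_zero _ hk)
  have h5 := ofReal_cosh_ne_zero (ξ + s)
  have h6 : 2 * Complex.I * k ≠ 0 := mul_ne_zero (mul_ne_zero two_ne_zero Complex.I_ne_zero) hk
  have h7 : 2 * Complex.I * k * (Real.cosh (ξ + s) : ℂ) ≠ 0 := mul_ne_zero h6 h5
  have h8 : 2 * k ^ 2 ≠ 0 := mul_ne_zero two_ne_zero (pow_ne_zero _ hk)
  unfold jostKernel residual phase
  fun_prop (disch := assumption)

theorem inv_cosh_le (t : ℝ) : (Real.cosh t)⁻¹ ≤ 2 * Real.exp (-t) := by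
  rw [inv_le_comm₀ (Real.cosh_pos t) (by positivity), mul_inv, ← Real.exp_neg, neg_neg,
    Real.cosh_eq]
  linarith [Real.exp_pos (-t)]

theorem exists_isVolterraKernel_jostKernel (Z : ℝ) (μ : ℂ) {δ : ℝ} (hδ : 0 < δ) :
    ∃ C : ℝ, 0 ≤ C ∧ IsVolterraKernel (jostKernel Z μ) (upperDomain δ) 0 C := by
  set F₀ : ℝ := 1 / 4 + 1 / 2 + |Z| / (2 * δ) + Z ^ 2 / (4 * δ ^ 2) + ‖μ‖ with hF₀
  have hF₀pos : 0 ≤ F₀ := by positivity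
  set K : ℝ := Real.exp (Z ^ 2 / δ ^ 3) with hK
  have hKpos : 0 ≤ K := (Real.exp_pos _).le
  -- The constant adds the bounds of the two components, which dominates their maximum.
  refine ⟨F₀ / δ * (1 + 1 / (2 * δ)) + |Z| / (2 * δ ^ 2) + K * F₀ * 2 * (1 + 1 / (2 * δ)),
    by positivity, ⟨fun p hp =>
      (continuousAt_jostKernel Z μ (ne_zero_of_mem_upperDomain hδ hp)).continuousWithinAt, ?_⟩⟩
  intro ξ hξ s hs k hk
  set t := ξ + s with ht
  set q : ℝ := Real.exp (-t / 2) with hq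
  have hqpos : 0 < q := Real.exp_pos _
  have hq1 : q ≤ 1 := Real.exp_le_one_iff.2 (by linarith)
  have hF : ‖residual Z μ t k‖ ≤ F₀ := norm_residual_le Z μ t hδ hk.2
  have hch : ‖(Real.cosh t : ℂ)‖⁻¹ ≤ 2 * (q * q) := by
    rw [Complex.norm_real, Real.norm_of_nonneg (Real.cosh_pos t).le, hq, ← Real.exp_add]
    convert inv_cosh_le t using 3
    ring
  have hk0 : 0 < ‖k‖ := hδ.trans_le hk.2
  have hβ : ‖residual Z μ t k / (2 * Complex.I * k * (Real.cosh t : ℂ))‖ ≤ F₀ / δ * q := by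
    rw [norm_div, norm_mul, norm_mul, norm_mul, Complex.norm_I, Complex.norm_ofNat, mul_one,
      div_eq_mul_inv, mul_inv, mul_inv]
    calc ‖residual Z μ t k‖ * (2⁻¹ * ‖k‖⁻¹ * ‖(Real.cosh t : ℂ)‖⁻¹)
        ≤ F₀ * (2⁻¹ * δ⁻¹ * (2 * (q * 1))) := by
          gcongr
          · exact hk.2
          · exact hch.trans (by gcongr)
      _ = F₀ / δ * q := by ring
  have hα : ‖(Z : ℂ) / (2 * k ^ 2) * (q : ℂ)‖ ≤ |Z| / (2 * δ ^ 2) * q := by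
    rw [norm_mul, norm_div, norm_mul, norm_pow, Complex.norm_real, Complex.norm_real,
      Complex.norm_ofNat, Real.norm_eq_abs, Real.norm_of_nonneg hqpos.le]
    gcongr
    exact hk.2
  have hl : ‖(q : ℂ) / (2 * Complex.I * k)‖ ≤ 1 / (2 * δ) := by
    rw [norm_div, norm_mul, norm_mul, Complex.norm_real, Complex.norm_I, Complex.norm_ofNat,
      mul_one, Real.norm_of_nonneg hqpos.le]
    gcongr
    exact hk.2
  have hγ : ‖(Real.exp (ξ / 2) : ℂ) * Complex.exp (2 * Complex.I * (phase Z t k - phase Z ξ k)) *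
        residual Z μ t k / (Real.cosh t : ℂ)‖ ≤ K * F₀ * 2 * q := by
    rw [norm_div, norm_mul, norm_mul, Complex.norm_real, Real.norm_of_nonneg (Real.exp_pos _).le,
      div_eq_mul_inv]
    -- Of the two factors $q=e^{-t/2}$ supplied by $1/\cosh t$, one absorbs the weight $e^{\xi/2}$
    -- and the other is the decay of the kernel.
    have he : Real.exp (ξ / 2) * q ≤ 1 := by
      rw [hq, ← Real.exp_add]
      exact Real.exp_le_one_iff.2 (by linarith)
    have hE := norm_exp_phase_sub_le (Z := Z) (ξ := ξ) (t := t) hδ hk.1 hk.2 (by linarith)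
    calc Real.exp (ξ / 2) * ‖Complex.exp (2 * Complex.I * (phase Z t k - phase Z ξ k))‖ *
          ‖residual Z μ t k‖ * ‖(Real.cosh t : ℂ)‖⁻¹
        ≤ Real.exp (ξ / 2) * K * F₀ * (2 * (q * q)) := by gcongr
      _ = (Real.exp (ξ / 2) * q) * (K * F₀ * 2 * q) := by ring
      _ ≤ 1 * (K * F₀ * 2 * q) := by gcongr
      _ = _ := one_mul _
  refine ContinuousLinearMap.opNorm_le_bound _ (by positivity) fun z => ?_
  rw [jostKernel_apply]
  have hz1 : ‖z.1‖ ≤ ‖z‖ := norm_fst_le z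
  have hz2 : ‖z.2‖ ≤ ‖z‖ := norm_snd_le z
  have hm : ‖z.1 - (q : ℂ) / (2 * Complex.I * k) * z.2‖ ≤ (1 + 1 / (2 * δ)) * ‖z‖ := by
    refine (norm_sub_le _ _).trans ?_
    rw [norm_mul, add_mul, one_mul]
    gcongr
  rw [Prod.norm_def, max_le_iff, ← ht]
  have hz := norm_nonneg z
  constructor
  · refine (norm_add_le _ _).trans ?_
    rw [norm_mul, norm_mul _ z.2]
    calc _ ≤ F₀ / δ * q * ((1 + 1 / (2 * δ)) * ‖z‖) + |Z| / (2 * δ ^ 2) * q * ‖z‖ := by gcongr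
      _ = (F₀ / δ * (1 + 1 / (2 * δ)) + |Z| / (2 * δ ^ 2) + 0) * q * ‖z‖ := by ring
      _ ≤ _ := by gcongr; positivity
  · rw [norm_mul]
    calc _ ≤ K * F₀ * 2 * q * ((1 + 1 / (2 * δ)) * ‖z‖) := by gcongr
      _ = (0 + K * F₀ * 2 * (1 + 1 / (2 * δ))) * q * ‖z‖ := by ring
      _ ≤ _ := by gcongr; positivity

end Kernel

/-! ### The solution in the closed upper half-plane -/

section JostSolution

/-- The solution of the Volterra equation with kernel `jostKernel`. -/
def jostPair (Z : ℝ) (μ : ℂ) (ξ : ℝ) (k : ℂ) : ℂ × ℂ :=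
  volterraSum (jostKernel Z μ) ((1, 0) : ℂ × ℂ) ξ k

/-- The factor `m` by which the decaying solution differs from the comparison function. -/
def jostFactor (Z : ℝ) (μ : ℂ) (ξ : ℝ) (k : ℂ) : ℂ :=
  (jostPair Z μ ξ k).1 - (Real.exp (-ξ / 2) : ℂ) / (2 * Complex.I * k) * (jostPair Z μ ξ k).2

variable {Z δ : ℝ} {μ : ℂ}

theorem continuousOn_jostPair (hδ : 0 < δ) :
    ContinuousOn (fun p : ℝ × ℂ => jostPair Z μ p.1 p.2) (Ioi 0 ×ˢ upperDomain δ) := by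
  obtain ⟨C, hC, hM⟩ := exists_isVolterraKernel_jostKernel Z μ hδ
  exact hM.continuousOn_sum hC

theorem continuousOn_jostFactor (hδ : 0 < δ) :
    ContinuousOn (fun p : ℝ × ℂ => jostFactor Z μ p.1 p.2) (Ioi 0 ×ˢ upperDomain δ) := by
  have h := continuousOn_jostPair (Z := Z) (μ := μ) hδ
  have h1 : ContinuousOn (fun p : ℝ × ℂ => (Real.exp (-p.1 / 2) : ℂ) / (2 * Complex.I * p.2))
      (Ioi 0 ×ˢ upperDomain δ) := by
    refine ContinuousOn.div (by fun_prop) (by fun_prop) fun p hp => ?_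
    exact mul_ne_zero (mul_ne_zero two_ne_zero Complex.I_ne_zero)
      (ne_zero_of_mem_upperDomain hδ hp.2)
  exact h.fst.sub (h1.mul h.snd)

theorem differentiableOn_jostFactor (hδ : 0 < δ) {ξ : ℝ} (hξ : 0 < ξ) :
    DifferentiableOn ℂ (jostFactor Z μ ξ) {k | 0 < k.im ∧ δ < ‖k‖} := by
  obtain ⟨C, hC, hM⟩ := exists_isVolterraKernel_jostKernel Z μ hδ
  have hU : IsOpen {k : ℂ | 0 < k.im ∧ δ < ‖k‖} :=
    (isOpen_lt continuous_const Complex.continuous_im).inter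
      (isOpen_lt continuous_const continuous_norm)
  have hne : ∀ k ∈ {k : ℂ | 0 < k.im ∧ δ < ‖k‖}, k ≠ 0 := fun k hk =>
    norm_pos_iff.1 (hδ.trans hk.2)
  have h := hM.differentiableOn_sum (e := ((1, 0) : ℂ × ℂ)) hC hU
    (fun k hk => ⟨hk.1.le, hk.2.le⟩)
    (fun x s k hk => (differentiableAt_jostKernel Z μ x s (hne k hk)).differentiableWithinAt) hξ
  have h1 : DifferentiableOn ℂ (fun k : ℂ => (Real.exp (-ξ / 2) : ℂ) / (2 * Complex.I * k))
      {k | 0 < k.im ∧ δ < ‖k‖} := by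
    refine DifferentiableOn.div (by fun_prop) (by fun_prop) fun k hk => ?_
    exact mul_ne_zero (mul_ne_zero two_ne_zero Complex.I_ne_zero) (hne k hk)
  exact h.fst.sub (h1.mul h.snd)

theorem exists_norm_jostFactor_sub_one_le (Z : ℝ) (μ : ℂ) (hδ : 0 < δ) :
    ∃ B : ℝ, ∀ ξ, 0 < ξ → ∀ k ∈ upperDomain δ,
      ‖jostFactor Z μ ξ k - 1‖ ≤ B * Real.exp (-ξ / 2) := by
  obtain ⟨C, hC, hM⟩ := exists_isVolterraKernel_jostKernel Z μ hδ
  obtain ⟨B, hB⟩ := hM.norm_sum_sub_le (e := ((1, 0) : ℂ × ℂ)) hC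
  refine ⟨B + 1 / (2 * δ) * B, fun ξ hξ k hk => ?_⟩
  have h := hB ξ hξ k hk
  have h1 := (norm_fst_le _).trans h
  have h2 := (norm_snd_le _).trans h
  simp only [Prod.fst_sub, Prod.snd_sub, sub_zero] at h1 h2
  have hl : ‖(Real.exp (-ξ / 2) : ℂ) / (2 * Complex.I * k)‖ ≤ 1 / (2 * δ) := by
    rw [norm_div, norm_mul, norm_mul, Complex.norm_real, Complex.norm_I, Complex.norm_ofNat,
      mul_one, Real.norm_of_nonneg (Real.exp_pos _).le]
    have := Real.exp_le_one_iff.2 (by linarith : -ξ / 2 ≤ 0)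
    gcongr
    exact hk.2
  have heq : jostFactor Z μ ξ k - 1 = ((jostPair Z μ ξ k).1 - 1) -
      (Real.exp (-ξ / 2) : ℂ) / (2 * Complex.I * k) * (jostPair Z μ ξ k).2 := by
    rw [jostFactor]; ring
  rw [heq]
  refine (norm_sub_le _ _).trans ?_
  rw [norm_mul, add_mul, mul_assoc (1 / (2 * δ))]
  exact add_le_add h1 (mul_le_mul hl h2 (norm_nonneg _) (by positivity))

theorem tendstoUniformlyOn_jostFactor (Z : ℝ) (μ : ℂ) (hδ : 0 < δ) :
    TendstoUniformlyOn (jostFactor Z μ) (fun _ => 1) atTop (upperDomain δ) := by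
  obtain ⟨B, hB⟩ := exists_norm_jostFactor_sub_one_le Z μ hδ
  rw [Metric.tendstoUniformlyOn_iff]
  intro ε hε
  filter_upwards [eventually_gt_atTop 0,
    (tendsto_const_mul_exp_neg_half B).eventually (gt_mem_nhds hε)] with ξ hξ h k hk
  rw [dist_comm, dist_eq_norm]
  exact (hB ξ hξ k hk).trans_lt h

/-- The Volterra equation becomes two scalar tail integrals, which can be differentiated; this
recovers the system for $m$ and $b=e^{-\xi/2}z_2$. -/
theorem hasDerivAt_jost_system (hδ : 0 < δ) {k : ℂ} (hk : k ∈ upperDomain δ) {ξ : ℝ}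
    (hξ : 0 < ξ) :
    HasDerivAt (fun ξ => jostFactor Z μ ξ k) ((Real.cosh ξ : ℂ) *
      ((Real.exp (-ξ / 2) : ℂ) * (jostPair Z μ ξ k).2)) ξ ∧
    HasDerivAt (fun ξ => (Real.exp (-ξ / 2) : ℂ) * (jostPair Z μ ξ k).2)
      (-2 * Complex.I * phaseDeriv Z ξ k * ((Real.exp (-ξ / 2) : ℂ) * (jostPair Z μ ξ k).2) -
      residual Z μ ξ k / (Real.cosh ξ : ℂ) * jostFactor Z μ ξ k) ξ := by
  obtain ⟨C, hC, hM⟩ := exists_isVolterraKernel_jostKernel Z μ hδ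
  have hk0 := ne_zero_of_mem_upperDomain hδ hk
  have hcu : ContinuousOn (fun ξ => jostPair Z μ ξ k) (Ioi 0) :=
    (continuousOn_jostPair hδ).comp (f := fun ξ : ℝ => (ξ, k)) (by fun_prop) fun y hy => ⟨hy, hk⟩
  have hcm : ContinuousOn (fun ξ => jostFactor Z μ ξ k) (Ioi 0) :=
    (continuousOn_jostFactor hδ).comp (f := fun ξ : ℝ => (ξ, k)) (by fun_prop)
      fun y hy => ⟨hy, hk⟩
  have hcr : Continuous fun ξ => residual Z μ ξ k := by
    rw [continuous_iff_continuousAt]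
    intro x
    exact (continuousAt_residual Z μ (p := (x, k)) hk0).comp (f := fun ξ : ℝ => (ξ, k))
      (by fun_prop)
  have hcp : Continuous fun ξ => phase Z ξ k := by
    rw [continuous_iff_continuousAt]
    exact fun x => (hasDerivAt_phase Z x k).continuousAt
  have hcc := continuous_ofReal_cosh
  let h₁ : ℝ → ℂ := fun t => residual Z μ t k / (2 * Complex.I * k * (Real.cosh t : ℂ)) *
    jostFactor Z μ t k + (Z : ℂ) / (2 * k ^ 2) * (Real.exp (-t / 2) : ℂ) * (jostPair Z μ t k).2
  let h₂ : ℝ → ℂ := fun t => Complex.exp (2 * Complex.I * phase Z t k) *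
    (residual Z μ t k / (Real.cosh t : ℂ) * jostFactor Z μ t k)
  have h2Ik : 2 * Complex.I * k ≠ 0 :=
    mul_ne_zero (mul_ne_zero two_ne_zero Complex.I_ne_zero) hk0
  have hc₁ : ContinuousOn h₁ (Ioi 0) := by
    have e1 : Continuous fun t => residual Z μ t k / (2 * Complex.I * k * (Real.cosh t : ℂ)) :=
      hcr.div (continuous_const.mul hcc) fun t => mul_ne_zero h2Ik (ofReal_cosh_ne_zero t)
    exact (e1.continuousOn.mul hcm).add (ContinuousOn.mul (by fun_prop) hcu.snd)
  have hc₂ : ContinuousOn h₂ (Ioi 0) := by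
    have e1 : Continuous fun t => residual Z μ t k / (Real.cosh t : ℂ) :=
      hcr.div hcc ofReal_cosh_ne_zero
    exact ContinuousOn.mul (by fun_prop) (e1.continuousOn.mul hcm)
  -- Besides $t=y+s$, the lower end $y$ enters only through a prefactor of the second component,
  -- which can be pulled out of the integral.
  have hap : ∀ y s, jostKernel Z μ y s k (jostPair Z μ (y + s) k) =
      (h₁ (y + s), ((Real.exp (y / 2) : ℂ) * Complex.exp (-(2 * Complex.I * phase Z y k))) *
        h₂ (y + s)) := by
    intro y s
    rw [jostKernel_apply]
    ext
    · rfl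
    · simp only [h₂, jostFactor]
      rw [show 2 * Complex.I * (phase Z (y + s) k - phase Z y k) =
        -(2 * Complex.I * phase Z y k) + 2 * Complex.I * phase Z (y + s) k by ring, Complex.exp_add]
      ring
  have hcst : ∀ y : ℝ,
      (Real.exp (y / 2) : ℂ) * Complex.exp (-(2 * Complex.I * phase Z y k)) ≠ 0 := fun y =>
    mul_ne_zero (by exact_mod_cast (Real.exp_pos _).ne') (Complex.exp_ne_zero _)
  have hInt : ∀ y, 0 < y → IntegrableOn (fun s => (h₁ (y + s),
      ((Real.exp (y / 2) : ℂ) * Complex.exp (-(2 * Complex.I * phase Z y k))) * h₂ (y + s)))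
      (Ioi 0) := by
    intro y hy
    refine (hM.integrableOn_sum (e := ((1, 0) : ℂ × ℂ)) hC hy hk).congr
      (Eventually.of_forall fun s => ?_)
    exact hap y s
  have hi₁ : ∀ y, 0 < y → IntegrableOn h₁ (Ioi y) := fun y hy =>
    integrableOn_Ioi_comp_add (hInt y hy).fst
  have hi₂ : ∀ y, 0 < y → IntegrableOn h₂ (Ioi y) := by
    intro y hy
    apply integrableOn_Ioi_comp_add
    refine ((hInt y hy).snd.const_mul
      ((Real.exp (y / 2) : ℂ) * Complex.exp (-(2 * Complex.I * phase Z y k)))⁻¹).congr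
      (Eventually.of_forall fun s => ?_)
    simp only
    rw [inv_mul_cancel_left₀ (hcst y)]
  have hu : ∀ y, 0 < y → jostPair Z μ y k = ((1 : ℂ) + ∫ t in Ioi y, h₁ t,
      ((Real.exp (y / 2) : ℂ) * Complex.exp (-(2 * Complex.I * phase Z y k))) *
        ∫ t in Ioi y, h₂ t) := by
    intro y hy
    have e1 := hM.sum_eq (e := ((1, 0) : ℂ × ℂ)) hC hy hk
    have e2 : ∫ s in Ioi (0 : ℝ), jostKernel Z μ y s k
        (volterraSum (jostKernel Z μ) ((1, 0) : ℂ × ℂ) (y + s) k) =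
        ∫ s in Ioi (0 : ℝ), (h₁ (y + s),
      ((Real.exp (y / 2) : ℂ) * Complex.exp (-(2 * Complex.I * phase Z y k))) * h₂ (y + s)) :=
      integral_congr_ae (Eventually.of_forall fun s => hap y s)
    rw [e2, integral_pair (hInt y hy).fst (hInt y hy).snd, integral_Ioi_comp_add h₁,
      integral_const_mul, integral_Ioi_comp_add h₂] at e1
    rw [jostPair, e1]
    simp
  have hd₁ : HasDerivAt (fun y => (jostPair Z μ y k).1) (-h₁ ξ) ξ := by
    refine ((hasDerivAt_integral_Ioi hc₁ hi₁ hξ).const_add (1 : ℂ)).congr_of_eventuallyEq ?_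
    filter_upwards [lt_mem_nhds hξ] with y hy
    rw [hu y hy]
  have hbeq : ∀ y, 0 < y → (Real.exp (-y / 2) : ℂ) * (jostPair Z μ y k).2 =
      Complex.exp (-(2 * Complex.I * phase Z y k)) * ∫ t in Ioi y, h₂ t := by
    intro y hy
    rw [hu y hy]
    have : (Real.exp (-y / 2) : ℂ) * (Real.exp (y / 2) : ℂ) = 1 := by
      rw [← Complex.ofReal_mul, ← Real.exp_add]
      ring_nf
      simp
    simp only
    rw [← mul_assoc, ← mul_assoc, this, one_mul]
  have hd₂ : HasDerivAt (fun ξ => (Real.exp (-ξ / 2) : ℂ) * (jostPair Z μ ξ k).2)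
      (-2 * Complex.I * phaseDeriv Z ξ k * ((Real.exp (-ξ / 2) : ℂ) * (jostPair Z μ ξ k).2) -
      residual Z μ ξ k / (Real.cosh ξ : ℂ) * jostFactor Z μ ξ k) ξ := by
    have e1 := (((hasDerivAt_phase Z ξ k).const_mul (2 * Complex.I)).neg.cexp).mul
      (hasDerivAt_integral_Ioi hc₂ hi₂ hξ)
    refine (e1.congr_of_eventuallyEq ?_).congr_deriv ?_
    · filter_upwards [lt_mem_nhds hξ] with y hy
      exact hbeq y hy
    · rw [hbeq ξ hξ]
      have : Complex.exp (-(2 * Complex.I * phase Z ξ k)) *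
          Complex.exp (2 * Complex.I * phase Z ξ k) = 1 := by
        rw [← Complex.exp_add]; simp
      simp only [h₂, Pi.neg_apply]
      linear_combination (-(residual Z μ ξ k / (Real.cosh ξ : ℂ) * jostFactor Z μ ξ k)) * this
  refine ⟨?_, hd₂⟩
  -- In the derivative of $z_1-b/(2ik)$ the $F$ and $Z$ terms cancel, leaving $b\cosh\xi$.
  have e3 := hd₁.sub (hd₂.div_const (2 * Complex.I * k))
  refine (e3.congr_of_eventuallyEq (Eventually.of_forall fun y => ?_)).congr_deriv ?_
  · simp only [jostFactor, Pi.sub_apply]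
    ring
  · simp only [h₁, phaseDeriv]
    have hI := Complex.I_ne_zero
    have hch := ofReal_cosh_ne_zero ξ
    field_simp
    ring

theorem isRadialPair_jost (hδ : 0 < δ) {k : ℂ} (hk : k ∈ upperDomain δ) :
    ∃ v', IsRadialPair Z μ k (fun ξ => comparison Z ξ k * jostFactor Z μ ξ k) v' :=
  ⟨_, isRadialPair_comparison_mul (ne_zero_of_mem_upperDomain hδ hk)
    (fun _ hξ => (hasDerivAt_jost_system hδ hk hξ).1)
    (fun _ hξ => (hasDerivAt_jost_system hδ hk hξ).2)⟩

end JostSolution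

/-! ### Growing solutions in the lower half-plane, and uniqueness in the closed upper one -/

section AllSolutions

/-- If `f' = o(h')` and `h → ∞` then `f = o(h)`. -/
theorem tendsto_norm_div_of_norm_deriv_le {f f' : ℝ → ℂ} {h h' : ℝ → ℝ}
    (hf : ∀ᶠ x in atTop, HasDerivAt f (f' x) x) (hh : ∀ᶠ x in atTop, HasDerivAt h (h' x) x)
    (hle : ∀ η : ℝ, 0 < η → ∀ᶠ x in atTop, ‖f' x‖ ≤ η * h' x) (htop : Tendsto h atTop atTop) :
    Tendsto (fun x => ‖f x‖ / h x) atTop (𝓝 0) := by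
  rw [Metric.tendsto_nhds]
  intro ε hε
  obtain ⟨T, hT⟩ := eventually_atTop.1 (hf.and (hh.and (hle (ε / 2) (by linarith))))
  -- The mean value inequality from $T$ on leaves a constant of integration, which $h\to\infty$
  -- makes negligible.
  have hlim : Tendsto (fun x => (‖f T‖ - ε / 2 * h T) / h x) atTop (𝓝 0) :=
    htop.const_div_atTop _
  filter_upwards [eventually_ge_atTop T, htop.eventually_gt_atTop 0,
    hlim.eventually (gt_mem_nhds (by linarith : (0 : ℝ) < ε / 2))] with x hx hpos hlt
  have hB : ∀ y, T ≤ y → HasDerivAt (fun y => ‖f T‖ + ε / 2 * (h y - h T)) (ε / 2 * h' y) y :=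
    fun y hy => (((hT y hy).2.1.sub_const _).const_mul _).const_add _
  have key := image_norm_le_of_norm_deriv_right_le_deriv_boundary' (a := T) (b := x)
    (f := f) (f' := f') (B := fun y => ‖f T‖ + ε / 2 * (h y - h T)) (B' := fun y => ε / 2 * h' y)
    (fun y hy => (hT y hy.1).1.continuousAt.continuousWithinAt)
    (fun y hy => (hT y hy.1).1.hasDerivWithinAt) (by simp)
    (fun y hy => (hB y hy.1).continuousAt.continuousWithinAt)
    (fun y hy => (hB y hy.1).hasDerivWithinAt) (fun y hy => (hT y hy.1).2.2)
    (right_mem_Icc.2 hx)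
  rw [Real.dist_eq, sub_zero, abs_of_nonneg (by positivity), div_lt_iff₀ hpos]
  rw [div_lt_iff₀ hpos] at hlt
  linarith

theorem tendsto_sinh_sub_mul_atTop (β : ℝ) :
    Tendsto (fun ξ => Real.sinh ξ - β * ξ) atTop atTop := by
  have h : Tendsto (fun ξ : ℝ => ξ * (ξ / 4 + -β)) atTop atTop :=
    tendsto_id.atTop_mul_atTop₀
      (tendsto_atTop_add_const_right _ _ (tendsto_id.atTop_div_const (by norm_num)))
  refine tendsto_atTop_mono' _ ?_ h
  filter_upwards [eventually_ge_atTop 0] with ξ hξ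
  have := sq_div_four_le_sinh hξ
  nlinarith

theorem comparison_ne_zero (Z ξ : ℝ) (k : ℂ) : comparison Z ξ k ≠ 0 := by
  refine mul_ne_zero ?_ (Complex.exp_ne_zero _)
  exact_mod_cast (inv_pos.2 (Real.sqrt_pos.2 (Real.cosh_pos ξ))).ne'

theorem comparison_neg (Z ξ : ℝ) (k : ℂ) :
    comparison Z ξ (-k) =
      comparison Z ξ k * Complex.exp (-(2 * Complex.I * phase Z ξ k)) := by
  rw [comparison, comparison, mul_assoc, ← Complex.exp_add, phase_neg]
  ring_nf

/-- Applied at $-k$, it evaluates the leading part of the integrand $1/v^2$ in the reduction of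
order. -/
theorem comparison_sq_mul_cosh (Z ξ : ℝ) (k : ℂ) :
    comparison Z ξ k ^ 2 * (Real.cosh ξ : ℂ) = Complex.exp (2 * Complex.I * phase Z ξ k) := by
  rw [comparison, mul_pow, ← Complex.exp_nat_mul]
  have h : ((((Real.sqrt (Real.cosh ξ))⁻¹ : ℝ) : ℂ)) ^ 2 * (Real.cosh ξ : ℂ) = 1 := by
    rw [← Complex.ofReal_pow, ← Complex.ofReal_mul, inv_pow, Real.sq_sqrt (Real.cosh_pos ξ).le,
      inv_mul_cancel₀ (Real.cosh_pos ξ).ne', Complex.ofReal_one]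
  rw [mul_right_comm, h, one_mul]
  push_cast
  ring_nf

theorem norm_exp_phase (Z ξ : ℝ) (k : ℂ) :
    ‖Complex.exp (2 * Complex.I * phase Z ξ k)‖ =
      Real.exp (-2 * k.im * (Real.sinh ξ - Z / (2 * ‖k‖ ^ 2) * ξ)) := by
  rw [Complex.norm_exp, mul_assoc]
  congr 1
  have := im_phase Z ξ k
  simp only [Complex.mul_re, Complex.re_ofNat, Complex.im_ofNat, Complex.I_re, Complex.I_im]
  rw [this]
  ring

variable {Z : ℝ} {μ k : ℂ}

theorem mem_upperDomain_norm {k : ℂ} (hk : 0 ≤ k.im) : k ∈ upperDomain ‖k‖ := ⟨hk, le_rfl⟩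

theorem tendsto_jostFactor (hk0 : k ≠ 0) (hk : 0 ≤ k.im) :
    Tendsto (fun ξ => jostFactor Z μ ξ k) atTop (𝓝 1) :=
  (tendstoUniformlyOn_jostFactor Z μ (norm_pos_iff.2 hk0)).tendsto_at (mem_upperDomain_norm hk)

theorem tendsto_ofReal_cosh_inv : Tendsto (fun ξ : ℝ => (Real.cosh ξ : ℂ)⁻¹) atTop (𝓝 0) := by
  have h : Tendsto (fun ξ : ℝ => (Real.cosh ξ)⁻¹) atTop (𝓝 0) :=
    squeeze_zero (fun ξ => (inv_pos.2 (Real.cosh_pos ξ)).le) inv_cosh_le (by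
      simpa using (Real.tendsto_exp_neg_atTop_nhds_zero).const_mul 2)
  have := (Complex.continuous_ofReal.tendsto 0).comp h
  simpa [Function.comp_def] using this

theorem IsRadialPair.of_neg {v v' : ℝ → ℂ} (h : IsRadialPair Z μ (-k) v v') :
    IsRadialPair Z μ k v v' := by
  intro ξ hξ
  have := h ξ hξ
  rwa [neg_sq] at this

/-- The growing solution. -/
theorem exists_growing_solution (Z : ℝ) (μ : ℂ) (hk : k.im < 0) :
    ∃ w w' : ℝ → ℂ, IsRadialPair Z μ k w w' ∧
      Tendsto (fun ξ => w ξ / comparison Z ξ k) atTop (𝓝 1) := by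
  have hk0 : k ≠ 0 := by rintro rfl; simp at hk
  have hnk0 : -k ≠ 0 := neg_ne_zero.2 hk0
  have hnk : 0 ≤ (-k).im := by simp; exact hk.le
  set m : ℝ → ℂ := fun ξ => jostFactor Z μ ξ (-k) with hm
  have hmlim : Tendsto m atTop (𝓝 1) := tendsto_jostFactor hnk0 hnk
  obtain ⟨v', hv'⟩ := isRadialPair_jost (Z := Z) (μ := μ) (norm_pos_iff.2 hnk0)
    (mem_upperDomain_norm hnk)
  have hv := hv'.of_neg
  set v : ℝ → ℂ := fun ξ => comparison Z ξ (-k) * jostFactor Z μ ξ (-k) with hvdef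
  have hmne : ∀ᶠ ξ in atTop, m ξ ≠ 0 := hmlim.eventually_ne one_ne_zero
  have hvne : ∀ᶠ ξ in atTop, v ξ ≠ 0 := hmne.mono fun ξ h =>
    mul_ne_zero (comparison_ne_zero _ _ _) h
  obtain ⟨ξ₀, hξ₀, hvξ₀⟩ := ((eventually_gt_atTop (0 : ℝ)).and hvne).exists
  obtain ⟨w, w', hw, hW⟩ := hv.exists_second_solution hξ₀ hvξ₀
  have h2Ik : 2 * Complex.I * k ≠ 0 :=
    mul_ne_zero (mul_ne_zero two_ne_zero Complex.I_ne_zero) hk0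
  set E : ℝ → ℂ := fun ξ => Complex.exp (2 * Complex.I * phase Z ξ k) with hE
  -- Wronskian $1$ gives $(w/v)'=v^{-2}=E\,m^{-2}\cosh\xi$, while $(E/(2ik))'=E(\cosh\xi+Z/(2k^2))$.
  -- The difference is $E\,\varepsilon\cosh\xi$ with $\varepsilon\to0$, hence $w/v\sim E/(2ik)$.
  set ε : ℝ → ℂ := fun ξ => (m ξ ^ 2)⁻¹ - 1 - (Z : ℂ) / (2 * k ^ 2) * (Real.cosh ξ : ℂ)⁻¹ with hε
  have hεlim : Tendsto ε atTop (𝓝 0) := by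
    have h1 : Tendsto (fun ξ => (m ξ ^ 2)⁻¹) atTop (𝓝 1) := by
      simpa using (hmlim.pow 2).inv₀ (by simp)
    have h2 := (h1.sub_const 1).sub (tendsto_ofReal_cosh_inv.const_mul ((Z : ℂ) / (2 * k ^ 2)))
    rw [sub_self, mul_zero, sub_zero] at h2
    exact h2
  set β := Z / (2 * ‖k‖ ^ 2) with hβ
  set h : ℝ → ℝ := fun ξ => Real.exp (-2 * k.im * (Real.sinh ξ - β * ξ)) with hh
  set f : ℝ → ℂ := fun ξ => w ξ / v ξ - E ξ / (2 * Complex.I * k) with hf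
  have hnormE : ∀ ξ, ‖E ξ‖ = h ξ := fun ξ => norm_exp_phase Z ξ k
  have hlim : Tendsto (fun ξ => ‖f ξ‖ / h ξ) atTop (𝓝 0) := by
    refine tendsto_norm_div_of_norm_deriv_le
      (f' := fun ξ => E ξ * (Real.cosh ξ : ℂ) * ε ξ)
      (h' := fun ξ => h ξ * (-2 * k.im * (Real.cosh ξ - β))) ?_ ?_ ?_ ?_
    · filter_upwards [eventually_gt_atTop 0, hvne, hmne] with ξ hξ hvξ hmξ
      have e1 := (hw ξ hξ).1.div (hv ξ hξ).1 hvξ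
      have e2 := (((hasDerivAt_phase Z ξ k).const_mul (2 * Complex.I)).cexp).div_const
        (2 * Complex.I * k)
      refine (e1.sub e2).congr_deriv ?_
      have e3 : w' ξ * v ξ - w ξ * v' ξ = 1 := by linear_combination hW ξ hξ
      have e4 : v ξ ^ 2 * (E ξ * (Real.cosh ξ : ℂ)) = m ξ ^ 2 := by
        have h1 := comparison_sq_mul_cosh Z ξ (-k)
        rw [phase_neg] at h1
        have h2 : Complex.exp (2 * Complex.I * -phase Z ξ k) * E ξ = 1 := by
          rw [hE, ← Complex.exp_add]; simp
        rw [hvdef]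
        linear_combination (jostFactor Z μ ξ (-k) ^ 2) * (E ξ * h1 + h2)
      have e5 : (v ξ ^ 2)⁻¹ = E ξ * (Real.cosh ξ : ℂ) * (m ξ ^ 2)⁻¹ := by
        rw [← e4]
        have hE0 : E ξ ≠ 0 := Complex.exp_ne_zero _
        have := ofReal_cosh_ne_zero ξ
        field_simp
      rw [e3, one_div, e5, hε, phaseDeriv]
      have hch := ofReal_cosh_ne_zero ξ
      have hI := Complex.I_ne_zero
      simp only
      field_simp
      ring
    · refine Eventually.of_forall fun ξ => ?_
      have e1 : HasDerivAt (fun ξ : ℝ => Real.sinh ξ - β * ξ) (Real.cosh ξ - β * 1) ξ :=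
        (Real.hasDerivAt_sinh ξ).sub ((hasDerivAt_id ξ).const_mul β)
      exact ((e1.const_mul (-2 * k.im)).exp).congr_deriv (by rw [mul_one])
    · intro η hη
      have hcosh : Tendsto Real.cosh atTop atTop :=
        tendsto_atTop_mono (fun ξ => (Real.sinh_lt_cosh ξ).le)
          (by simpa using tendsto_sinh_sub_mul_atTop 0)
      have hεn : Tendsto (fun ξ => ‖ε ξ‖) atTop (𝓝 0) := by simpa using hεlim.norm
      -- Once $\cosh\xi\ge2\beta$, one has $\cosh\xi\le2(\cosh\xi-\beta)$, which explains the factor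
      -- in the bound on $\varepsilon$.
      filter_upwards [hεn.eventually (gt_mem_nhds (by nlinarith : (0 : ℝ) < η * (-k.im))),
        hcosh.eventually_ge_atTop (2 * β)] with ξ h1 h2
      rw [norm_mul, norm_mul, hnormE, Complex.norm_real,
        Real.norm_of_nonneg (Real.cosh_pos ξ).le]
      have h3 : 0 < h ξ := Real.exp_pos _
      have hc := Real.cosh_pos ξ
      calc h ξ * Real.cosh ξ * ‖ε ξ‖ ≤ h ξ * Real.cosh ξ * (η * (-k.im)) := by gcongr
        _ = h ξ * (η * (-k.im)) * Real.cosh ξ := by ring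
        _ ≤ h ξ * (η * (-k.im)) * (2 * (Real.cosh ξ - β)) := by
          have : 0 ≤ h ξ * (η * (-k.im)) := by
            have : 0 < -k.im := by linarith
            positivity
          gcongr
          linarith
        _ = η * (h ξ * (-2 * k.im * (Real.cosh ξ - β))) := by ring
    · exact Real.tendsto_exp_atTop.comp
        ((tendsto_sinh_sub_mul_atTop β).const_mul_atTop (by linarith))
  have hlim2 : Tendsto (fun ξ => f ξ / E ξ) atTop (𝓝 0) := by
    rw [tendsto_zero_iff_norm_tendsto_zero]
    refine hlim.congr fun ξ => ?_
    rw [norm_div, hnormE]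
  -- The factor $2ik$ normalises: $2ikw\sim vE=ym\sim y$.
  refine ⟨_, _, hw.const_mul (2 * Complex.I * k), ?_⟩
  have hfin := ((hlim2.const_mul (2 * Complex.I * k)).add_const 1).mul hmlim
  rw [mul_zero, zero_add, one_mul] at hfin
  refine hfin.congr' ?_
  filter_upwards [hvne] with ξ hvξ
  have hE0 : E ξ ≠ 0 := Complex.exp_ne_zero _
  have hy := comparison_ne_zero Z ξ k
  have e1 : v ξ * E ξ = comparison Z ξ k * m ξ := by
    have h2 : Complex.exp (-(2 * Complex.I * phase Z ξ k)) * E ξ = 1 := by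
      rw [hE, ← Complex.exp_add]; simp
    simp only [hvdef, hm]
    rw [comparison_neg]
    linear_combination (comparison Z ξ k * jostFactor Z μ ξ (-k)) * h2
  have e2 : 2 * Complex.I * k * (f ξ / E ξ) + 1 = 2 * Complex.I * k * w ξ / (v ξ * E ξ) := by
    simp only [hf]
    have hI := Complex.I_ne_zero
    field_simp
    ring
  have hm0 : m ξ ≠ 0 := right_ne_zero_of_mul hvξ
  rw [e2, e1]
  field_simp

theorem eq_of_tendsto_of_frequently_eq {f : ℝ → ℝ} {a c : ℝ} (h : Tendsto f atTop (𝓝 a))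
    (hc : ∃ᶠ x in atTop, f x = c) : a = c := by
  by_contra hne
  exact hc (h.eventually_ne hne)

/-- `exp(-2iψ)` has no limit in the closed upper half-plane. -/
theorem not_tendsto_exp_phase (Z : ℝ) (hk0 : k ≠ 0) (hk : 0 ≤ k.im) (a : ℂ) :
    ¬ Tendsto (fun ξ => Complex.exp (-(2 * Complex.I * phase Z ξ k))) atTop (𝓝 a) := by
  intro h
  rcases hk.lt_or_eq with hpos | hzero
  · refine not_tendsto_nhds_of_tendsto_atTop ?_ ‖a‖ h.norm
    have e : ∀ ξ, ‖Complex.exp (-(2 * Complex.I * phase Z ξ k))‖ =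
        Real.exp (2 * k.im * (Real.sinh ξ - Z / (2 * ‖k‖ ^ 2) * ξ)) := by
      intro ξ
      rw [Complex.exp_neg, norm_inv, norm_exp_phase, ← Real.exp_neg]
      ring_nf
    simp_rw [e]
    exact Real.tendsto_exp_atTop.comp
      ((tendsto_sinh_sub_mul_atTop _).const_mul_atTop (by linarith))
  · have hkr : k = (k.re : ℂ) := by
      apply Complex.ext <;> simp [hzero.symm]
    set r := k.re with hr
    have hr0 : r ≠ 0 := by
      intro h0; apply hk0; rw [hkr, h0]; simp
    set θ : ℝ → ℝ := fun ξ => Real.sinh ξ - (-Z / (2 * r ^ 2)) * ξ with hθ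
    have hθtop : Tendsto θ atTop atTop := tendsto_sinh_sub_mul_atTop _
    have hθcont : Continuous θ := by
      have := Real.continuous_sinh
      fun_prop
    have hre : Tendsto (fun ξ => Real.cos (2 * |r| * θ ξ)) atTop (𝓝 a.re) := by
      have h1 := (Complex.continuous_re.tendsto a).comp h
      refine h1.congr fun ξ => ?_
      have h2 : -(2 * Complex.I * phase Z ξ k) = ((-(2 * r * θ ξ) : ℝ) : ℂ) * Complex.I := by
        have hr0' : (r : ℂ) ≠ 0 := by exact_mod_cast hr0
        rw [hkr, phase, hθ]
        push_cast
        field_simp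
        ring
      simp only [Function.comp_apply]
      rw [h2, Complex.exp_ofReal_mul_I_re, Real.cos_neg]
      rcases abs_choice r with h3 | h3
      · rw [h3]
      · rw [h3, ← Real.cos_neg]
        ring_nf
    -- For real $k$ the phase is real, continuous and unbounded. By intermediate values its double
    -- meets $2\pi n$ and $2\pi n+\pi$ arbitrarily far out, so the cosine would have limits $1$ and
    -- $-1$.
    have hfreq : ∀ d : ℝ, ∃ᶠ ξ in atTop, ∃ n : ℕ, 2 * |r| * θ ξ = n * (2 * Real.pi) + d := by
      intro d
      rw [frequently_atTop]
      intro N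
      have hlim : Tendsto (fun n : ℕ => ((n : ℝ) * (2 * Real.pi) + d) / (2 * |r|)) atTop atTop := by
        apply Tendsto.atTop_div_const (by positivity)
        apply tendsto_atTop_add_const_right
        exact tendsto_natCast_atTop_atTop.atTop_mul_const (by positivity)
      obtain ⟨n, hn⟩ := (hlim.eventually_ge_atTop (θ N)).exists
      obtain ⟨T, hT, hTN⟩ := ((hθtop.eventually_ge_atTop
        (((n : ℝ) * (2 * Real.pi) + d) / (2 * |r|))).and (eventually_ge_atTop N)).exists
      obtain ⟨x, hx, hxe⟩ := intermediate_value_Icc hTN hθcont.continuousOn ⟨hn, hT⟩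
      refine ⟨x, hx.1, n, ?_⟩
      have : |r| ≠ 0 := abs_ne_zero.2 hr0
      rw [hxe]
      field_simp
    have h1 : a.re = 1 := eq_of_tendsto_of_frequently_eq hre ((hfreq 0).mono (by
      rintro ξ ⟨n, hn⟩
      rw [hn, add_zero, Real.cos_nat_mul_two_pi]))
    have h2 : a.re = -1 := eq_of_tendsto_of_frequently_eq hre ((hfreq Real.pi).mono (by
      rintro ξ ⟨n, hn⟩
      rw [hn, Real.cos_nat_mul_two_pi_add_pi]))
    linarith

/-- A solution for every `k ≠ 0`, given by the Volterra equation in the closed upper half-plane. -/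
theorem exists_jost_solution (Z : ℝ) (μ : ℂ) :
    ∃ V : ℝ → ℂ → ℂ,
      (∀ k : ℂ, k ≠ 0 → (∃ v', IsRadialPair Z μ k (fun ξ => V ξ k) v') ∧
        Tendsto (fun ξ => V ξ k / comparison Z ξ k) atTop (𝓝 1)) ∧
      ∀ ξ k, 0 ≤ k.im → V ξ k = comparison Z ξ k * jostFactor Z μ ξ k := by
  have h : ∀ k : ℂ, ∃ v : ℝ → ℂ, (k ≠ 0 → (∃ v', IsRadialPair Z μ k v v') ∧
        Tendsto (fun ξ => v ξ / comparison Z ξ k) atTop (𝓝 1)) ∧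
      ∀ ξ, 0 ≤ k.im → v ξ = comparison Z ξ k * jostFactor Z μ ξ k := by
    intro k
    rcases le_or_gt 0 k.im with hk | hk
    · refine ⟨fun ξ => comparison Z ξ k * jostFactor Z μ ξ k, fun hk0 => ⟨?_, ?_⟩, fun _ _ => rfl⟩
      · exact isRadialPair_jost (norm_pos_iff.2 hk0) (mem_upperDomain_norm hk)
      · refine (tendsto_jostFactor (Z := Z) (μ := μ) hk0 hk).congr fun ξ => ?_
        rw [mul_div_cancel_left₀ _ (comparison_ne_zero Z ξ k)]
    -- Below the real axis any growing solution will do: adding a multiple of the decaying one keeps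
    -- the asymptotics, and no regularity in $k$ is asked there.
    · obtain ⟨w, w', hw, hlim⟩ := exists_growing_solution Z μ hk
      exact ⟨w, fun _ => ⟨⟨w', hw⟩, hlim⟩, fun _ h => absurd h (not_le.2 hk)⟩
  choose V hV using h
  exact ⟨fun ξ k => V k ξ, fun k hk => (hV k).1 hk, fun ξ k hk => (hV k).2 ξ hk⟩

/-- Solutions in the closed upper half-plane are determined by their leading asymptotics. -/
theorem IsRadialPair.eq_of_tendsto {v v' w w' : ℝ → ℂ} (hk0 : k ≠ 0) (hk : 0 ≤ k.im)
    (hv : IsRadialPair Z μ k v v') (hw : IsRadialPair Z μ k w w') {c : ℂ}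
    (hvc : Tendsto (fun ξ => v ξ / comparison Z ξ k) atTop (𝓝 c))
    (hwc : Tendsto (fun ξ => w ξ / comparison Z ξ k) atTop (𝓝 c)) :
    ∀ ξ, 0 < ξ → v ξ = w ξ := by
  obtain ⟨V, hV, -⟩ := exists_jost_solution Z μ
  obtain ⟨⟨v₀', hv₀⟩, hlim₀⟩ := hV k hk0
  obtain ⟨⟨v₁', hv₁'⟩, hlim₁⟩ := hV (-k) (neg_ne_zero.2 hk0)
  have hv₁ := hv₁'.of_neg
  have hyne := fun ξ => comparison_ne_zero Z ξ k
  have hne : ∀ᶠ ξ in atTop, V ξ k ≠ 0 := (hlim₀.eventually_ne one_ne_zero).mono fun ξ h h0 => by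
    simp [h0] at h
  have hlim₀' : Tendsto (fun ξ => comparison Z ξ k / V ξ k) atTop (𝓝 1) := by
    simpa using hlim₀.inv₀ one_ne_zero
  obtain ⟨ξ₀, hξ₀, hvξ₀⟩ := ((eventually_gt_atTop (0 : ℝ)).and hne).exists
  obtain ⟨u, u', hu, hW⟩ := hv₀.exists_second_solution hξ₀ hvξ₀
  have hd := hv.sub hw
  obtain ⟨α, hα⟩ := hd.exists_wronskian_eq hu
  obtain ⟨β, hβ⟩ := hv₀.exists_wronskian_eq hd
  obtain ⟨α₁, hα₁⟩ := hv₁.exists_wronskian_eq hu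
  obtain ⟨β₁, hβ₁⟩ := hv₀.exists_wronskian_eq hv₁
  have hrep : ∀ ξ, 0 < ξ → v ξ - w ξ = V ξ k * α + u ξ * β := by
    intro ξ hξ
    linear_combination (-(v ξ - w ξ)) * hW ξ hξ + V ξ k * hα ξ hξ + u ξ * hβ ξ hξ
  have hrep₁ : ∀ ξ, 0 < ξ → V ξ (-k) = V ξ k * α₁ + u ξ * β₁ := by
    intro ξ hξ
    linear_combination (-(V ξ (-k))) * hW ξ hξ + V ξ k * hα₁ ξ hξ + u ξ * hβ₁ ξ hξ
  have hdlim : Tendsto (fun ξ => α + β * (u ξ / V ξ k)) atTop (𝓝 0) := by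
    have h1 := (hvc.sub hwc).mul hlim₀'
    rw [sub_self, zero_mul] at h1
    refine h1.congr' ?_
    filter_upwards [eventually_gt_atTop 0, hne] with ξ hξ hVξ
    rw [← sub_div, hrep ξ hξ]
    have := hyne ξ
    field_simp
  -- If $\beta\ne0$, then $u/V(\cdot,k)$ converges, hence so does $V(\cdot,-k)/V(\cdot,k)$, which is
  -- asymptotic to $e^{-2i\psi}$.
  have hβ0 : β = 0 := by
    by_contra hβ0
    have h1 : Tendsto (fun ξ => u ξ / V ξ k) atTop (𝓝 (β⁻¹ * (0 - α))) := by
      refine ((hdlim.sub_const α).const_mul β⁻¹).congr fun ξ => ?_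
      field_simp
      ring
    have h2 : Tendsto (fun ξ => V ξ (-k) / V ξ k) atTop (𝓝 (α₁ + β₁ * (β⁻¹ * (0 - α)))) := by
      refine ((h1.const_mul β₁).const_add α₁).congr' ?_
      filter_upwards [eventually_gt_atTop 0, hne] with ξ hξ hVξ
      rw [hrep₁ ξ hξ]
      field_simp
    have h3 : Tendsto (fun ξ => comparison Z ξ (-k) / V ξ (-k)) atTop (𝓝 1) := by
      simpa using hlim₁.inv₀ one_ne_zero
    have hne₁ : ∀ᶠ ξ in atTop, V ξ (-k) ≠ 0 :=
      (hlim₁.eventually_ne one_ne_zero).mono fun ξ h h0 => by simp [h0] at h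
    refine not_tendsto_exp_phase Z hk0 hk _ (((h3.mul h2).mul hlim₀).congr' ?_)
    filter_upwards [hne, hne₁] with ξ hξ hξ₁
    rw [comparison_neg]
    have := hyne ξ
    field_simp
  have hα0 : α = 0 := by
    simp only [hβ0, zero_mul, add_zero] at hdlim
    exact tendsto_nhds_unique tendsto_const_nhds hdlim
  intro ξ hξ
  have := hrep ξ hξ
  rw [hα0, hβ0, mul_zero, mul_zero, add_zero] at this
  exact sub_eq_zero.1 this

end AllSolutions

/-! ### A global phase function against the comparison phase -/

section PhaseLimit

theorem cpow_half_sq (z : ℂ) : (z ^ (1 / 2 : ℂ)) ^ 2 = z := by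
  have := Complex.cpow_nat_inv_pow z (n := 2) two_ne_zero
  simpa only [one_div, Nat.cast_ofNat] using this

theorem re_cpow_half_nonneg (z : ℂ) : 0 ≤ (z ^ (1 / 2 : ℂ)).re := by
  by_cases hz : z = 0
  · simp [hz]
  · rw [Complex.cpow_def_of_ne_zero hz, Complex.exp_re]
    have him : (Complex.log z * (1 / 2)).im = z.arg / 2 := by
      rw [show (1 / 2 : ℂ) = ((1 / 2 : ℝ) : ℂ) by norm_num, Complex.im_mul_ofReal, Complex.log_im]
      ring
    rw [him]
    refine mul_nonneg (Real.exp_pos _).le (Real.cos_nonneg_of_mem_Icc ⟨?_, ?_⟩)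
    · linarith [Complex.neg_pi_lt_arg z]
    · linarith [Complex.arg_le_pi z]

/-- With $w^2=1-z$ the left side is $|w-1|^2/2$. Since $\operatorname{Re}w\ge0$ for the principal
root, $|w-1|=|z|/|w+1|\le|z|$; no smallness of $z$ is needed. -/
theorem norm_cpow_half_sub_le (z : ℂ) :
    ‖(1 - z) ^ (1 / 2 : ℂ) - 1 + z / 2‖ ≤ ‖z‖ ^ 2 / 2 := by
  set w := (1 - z) ^ (1 / 2 : ℂ) with hw
  have h1 : w ^ 2 = 1 - z := cpow_half_sq _
  have h2 : 0 ≤ w.re := re_cpow_half_nonneg _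
  have h3 : 1 ≤ ‖w + 1‖ := by
    have := Complex.re_le_norm (w + 1)
    simp at this
    linarith
  have h4 : w - 1 + z / 2 = -((w - 1) ^ 2 / 2) := by linear_combination (1 / 2 : ℂ) * h1
  have h5 : ‖w - 1‖ ≤ ‖z‖ := by
    have e : (w - 1) * (w + 1) = -z := by linear_combination h1
    have := congrArg norm e
    rw [norm_mul, norm_neg] at this
    nlinarith [norm_nonneg (w - 1)]
  rw [h4, norm_neg, norm_div, norm_pow, Complex.norm_ofNat]
  gcongr

/-- The integrand of the difference between the local phase and the comparison phase. -/
def phaseDefect (Z : ℝ) (l : ℝ → ℝ) (k : ℂ) (τ : ℝ) : ℂ :=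
  k * (1 - (l τ : ℂ) / k ^ 2) ^ (1 / 2 : ℂ) -
    (k + (Z : ℂ) / (2 * k) * (((Real.sqrt (1 + τ ^ 2))⁻¹ : ℝ) : ℂ))

variable {Z δ : ℝ} {μ k : ℂ} {j : ℕ} {l : ℝ → ℝ}

/-- The quadratic remainder of the root is at most $l^2/(2|k|^3)$ and the linear part is
$(l+Z/\sqrt{1+\tau^2})/(2k)$. Beyond $R$ the linear part vanishes and $l^2=Z^2/(1+\tau^2)$; up to
$R$ a constant bound is multiplied by $(1+R^2)/(1+\tau^2)\ge1$. -/
theorem exists_norm_phaseDefect_le (hj : 1 ≤ j) (hl : IsLongRangePart Z μ j l) (hδ : 0 < δ) :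
    ∃ C : ℝ, 0 ≤ C ∧ ∀ τ, 0 < τ → ∀ k : ℂ, δ ≤ ‖k‖ →
      ‖phaseDefect Z l k τ‖ ≤ C * (1 + τ ^ 2)⁻¹ := by
  obtain ⟨R, hR⟩ := hl.eq_of_large
  set C₁ := Z ^ 2 / (2 * δ ^ 3) with hC₁
  set C₂ := 1 / (2 * δ ^ 3) + (1 + |Z|) / (2 * δ) with hC₂
  have hC₁0 : 0 ≤ C₁ := by positivity
  have hC₂0 : 0 ≤ C₂ := by positivity
  refine ⟨C₁ + C₂ * (1 + R ^ 2), by positivity, fun τ hτ k hk => ?_⟩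
  have hk0 : 0 < ‖k‖ := hδ.trans_le hk
  have hkne : k ≠ 0 := norm_pos_iff.1 hk0
  set s := (Real.sqrt (1 + τ ^ 2))⁻¹ with hs
  have hτ1 : 0 < 1 + τ ^ 2 := by positivity
  have hs2 : s ^ 2 = (1 + τ ^ 2)⁻¹ := by rw [hs, inv_pow, Real.sq_sqrt hτ1.le]
  have hs0 : 0 ≤ s := by positivity
  have hs1 : s ≤ 1 := by
    have h1 : s ^ 2 ≤ 1 := by
      rw [hs2]
      exact inv_le_one_of_one_le₀ (by nlinarith [sq_nonneg τ])
    nlinarith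
  have hsplit : phaseDefect Z l k τ =
      k * ((1 - (l τ : ℂ) / k ^ 2) ^ (1 / 2 : ℂ) - 1 + (l τ : ℂ) / k ^ 2 / 2) -
        ((l τ + Z * s : ℝ) : ℂ) / (2 * k) := by
    rw [phaseDefect, ← hs]
    generalize (1 - (l τ : ℂ) / k ^ 2) ^ (1 / 2 : ℂ) = w
    push_cast
    field_simp
    ring
  have hmain : ‖phaseDefect Z l k τ‖ ≤ l τ ^ 2 / (2 * δ ^ 3) + |l τ + Z * s| / (2 * δ) := by
    rw [hsplit]
    refine (norm_sub_le _ _).trans (add_le_add ?_ ?_)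
    · rw [norm_mul]
      calc _ ≤ ‖k‖ * (‖(l τ : ℂ) / k ^ 2‖ ^ 2 / 2) := by
            gcongr
            exact norm_cpow_half_sub_le _
        _ = l τ ^ 2 / (2 * ‖k‖ ^ 3) := by
            rw [norm_div, Complex.norm_real, norm_pow, div_pow, Real.norm_eq_abs, sq_abs]
            field_simp
        _ ≤ _ := by gcongr
    · rw [norm_div, Complex.norm_real, norm_mul, Complex.norm_ofNat, Real.norm_eq_abs]
      gcongr
  refine hmain.trans ?_
  rcases lt_or_ge R τ with h | h
  · have h1 : l τ = -(Z * s) := by rw [hR τ h, hs, div_eq_mul_inv]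
    have h2 : |l τ + Z * s| = 0 := by rw [h1]; simp
    have h3 : l τ ^ 2 / (2 * δ ^ 3) = C₁ * (1 + τ ^ 2)⁻¹ := by
      rw [h1, neg_sq, mul_pow, hs2, hC₁]
      ring
    rw [h2, h3, zero_div, add_zero]
    gcongr
    have : 0 ≤ C₂ * (1 + R ^ 2) := by positivity
    linarith
  · have h1 : |l τ| ≤ 1 := (hl.abs_le τ hτ).trans (by
      rw [div_le_one (by positivity)]
      exact_mod_cast hj)
    have h2 : l τ ^ 2 ≤ 1 := by rw [← sq_abs]; exact pow_le_one₀ (abs_nonneg _) h1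
    have h3 : |l τ + Z * s| ≤ 1 + |Z| := by
      refine (abs_add_le _ _).trans (add_le_add h1 ?_)
      rw [abs_mul, abs_of_nonneg hs0]
      exact mul_le_of_le_one_right (abs_nonneg _) hs1
    have h4 : 1 ≤ (1 + R ^ 2) * (1 + τ ^ 2)⁻¹ := by
      rw [← div_eq_mul_inv, one_le_div hτ1]
      nlinarith
    calc l τ ^ 2 / (2 * δ ^ 3) + |l τ + Z * s| / (2 * δ) ≤ C₂ := by
          rw [hC₂]
          gcongr
      _ ≤ C₂ * ((1 + R ^ 2) * (1 + τ ^ 2)⁻¹) := le_mul_of_one_le_right hC₂0 h4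
      _ ≤ (C₁ + C₂ * (1 + R ^ 2)) * (1 + τ ^ 2)⁻¹ := by
          have : 0 ≤ C₁ * (1 + τ ^ 2)⁻¹ := by positivity
          linarith

/-- The condition $1/j<\delta^2$ forces $|l/k^2|<1$, which keeps the root off its cut. -/
theorem one_sub_div_sq_mem_slitPlane (hl : IsLongRangePart Z μ j l) (hjδ : 1 / (j : ℝ) < δ ^ 2)
    (hδ : 0 < δ) (hk : δ ≤ ‖k‖) {τ : ℝ} (hτ : 0 < τ) :
    1 - (l τ : ℂ) / k ^ 2 ∈ Complex.slitPlane := by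
  rw [sub_eq_add_neg]
  apply Complex.mem_slitPlane_of_norm_lt_one
  rw [norm_neg, norm_div, norm_pow, Complex.norm_real, Real.norm_eq_abs,
    div_lt_one (by have := hδ.trans_le hk; positivity)]
  exact ((hl.abs_le τ hτ).trans_lt hjδ).trans_le (by gcongr)

theorem continuousOn_phaseDefect (hl : IsLongRangePart Z μ j l) (hjδ : 1 / (j : ℝ) < δ ^ 2)
    (hδ : 0 < δ) (hk : δ ≤ ‖k‖) : ContinuousOn (phaseDefect Z l k) (Ioi 0) := by
  have h1 : ContinuousOn (fun τ => 1 - (l τ : ℂ) / k ^ 2) (Ioi 0) :=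
    continuousOn_const.sub
      ((Complex.continuous_ofReal.comp_continuousOn hl.contDiffOn.continuousOn).div_const _)
  have h2 : ContinuousOn (fun τ => (1 - (l τ : ℂ) / k ^ 2) ^ (1 / 2 : ℂ)) (Ioi 0) :=
    h1.cpow continuousOn_const fun τ hτ => one_sub_div_sq_mem_slitPlane hl hjδ hδ hk hτ
  have h3 : Continuous fun τ : ℝ => (((Real.sqrt (1 + τ ^ 2))⁻¹ : ℝ) : ℂ) := by
    refine Complex.continuous_ofReal.comp (Continuous.inv₀ (by fun_prop) fun τ => ?_)
    positivity
  exact (continuousOn_const.mul h2).sub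
    (continuousOn_const.add (continuousOn_const.mul h3.continuousOn))

theorem integrableOn_phaseDefect (hj : 1 ≤ j) (hl : IsLongRangePart Z μ j l)
    (hjδ : 1 / (j : ℝ) < δ ^ 2) (hδ : 0 < δ) (hk : δ ≤ ‖k‖) :
    IntegrableOn (phaseDefect Z l k) (Ioi 0) := by
  obtain ⟨C, -, hC⟩ := exists_norm_phaseDefect_le hj hl hδ
  refine (integrable_inv_one_add_sq.integrableOn.const_mul C).mono'
    ((continuousOn_phaseDefect hl hjδ hδ hk).aestronglyMeasurable measurableSet_Ioi) ?_
  filter_upwards [ae_restrict_mem measurableSet_Ioi] with τ hτ using hC τ hτ k hk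

/-- Source of the term $Z\xi/(2k)$ in the comparison phase. -/
theorem integral_inv_sqrt_one_add_sq_sinh (ξ : ℝ) :
    ∫ τ in (0 : ℝ)..Real.sinh ξ, (((Real.sqrt (1 + τ ^ 2))⁻¹ : ℝ) : ℂ) = ξ := by
  rw [intervalIntegral.integral_ofReal,
    intervalIntegral.integral_eq_sub_of_hasDerivAt (fun x _ => Real.hasDerivAt_arsinh x)]
  · simp
  · apply Continuous.intervalIntegrable
    exact Continuous.inv₀ (by fun_prop) fun τ => by positivity

theorem localPhase_sub_phase (hj : 1 ≤ j) (hl : IsLongRangePart Z μ j l)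
    (hjδ : 1 / (j : ℝ) < δ ^ 2) (hδ : 0 < δ) (hk : δ ≤ ‖k‖) {ξ : ℝ} (hξ : 0 < ξ) :
    localPhase l ξ k - phase Z ξ k = ∫ τ in (0 : ℝ)..Real.sinh ξ, phaseDefect Z l k τ := by
  have hsinh : 0 < Real.sinh ξ := Real.sinh_pos_iff.2 hξ
  have h3 : Continuous fun τ : ℝ => (((Real.sqrt (1 + τ ^ 2))⁻¹ : ℝ) : ℂ) := by
    refine Complex.continuous_ofReal.comp (Continuous.inv₀ (by fun_prop) fun τ => ?_)
    positivity
  have h4 : Continuous fun τ : ℝ =>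
      k + (Z : ℂ) / (2 * k) * (((Real.sqrt (1 + τ ^ 2))⁻¹ : ℝ) : ℂ) := by fun_prop
  have hInt : IntervalIntegrable (phaseDefect Z l k) volume 0 (Real.sinh ξ) := by
    rw [intervalIntegrable_iff_integrableOn_Ioc_of_le hsinh.le]
    exact (integrableOn_phaseDefect hj hl hjδ hδ hk).mono_set Ioc_subset_Ioi_self
  have hphase : phase Z ξ k = ∫ τ in (0 : ℝ)..Real.sinh ξ,
      (k + (Z : ℂ) / (2 * k) * (((Real.sqrt (1 + τ ^ 2))⁻¹ : ℝ) : ℂ)) := by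
    rw [intervalIntegral.integral_add intervalIntegrable_const
      (Continuous.intervalIntegrable (by fun_prop) _ _), intervalIntegral.integral_const,
      intervalIntegral.integral_const_mul, integral_inv_sqrt_one_add_sq_sinh, phase,
      Complex.real_smul]
    push_cast
    ring
  rw [hphase, sub_eq_iff_eq_add, ← intervalIntegral.integral_add hInt (h4.intervalIntegrable _ _)]
  simp [localPhase, phaseDefect]

/-- The tail of the defect integral beyond $\sinh\xi$ is dominated by that of $C/(1+\tau^2)$, in
which $k$ does not occur. -/
theorem tendstoUniformlyOn_localPhase_sub_phase (hj : 1 ≤ j) (hl : IsLongRangePart Z μ j l)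
    (hjδ : 1 / (j : ℝ) < δ ^ 2) (hδ : 0 < δ) :
    TendstoUniformlyOn (fun ξ k => localPhase l ξ k - phase Z ξ k)
      (fun k => ∫ τ in Ioi (0 : ℝ), phaseDefect Z l k τ) atTop {k | δ ≤ ‖k‖} := by
  obtain ⟨C, hC0, hC⟩ := exists_norm_phaseDefect_le hj hl hδ
  have hlim : Tendsto (fun ξ => C * (Real.pi / 2 - Real.arctan (Real.sinh ξ))) atTop (𝓝 0) := by
    have h1 : Tendsto Real.sinh atTop atTop := by simpa using tendsto_sinh_sub_mul_atTop 0
    have h2 := (tendsto_nhds_of_tendsto_nhdsWithin Real.tendsto_arctan_atTop).comp h1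
    simpa using (h2.const_sub (Real.pi / 2)).const_mul C
  rw [Metric.tendstoUniformlyOn_iff]
  intro ε hε
  filter_upwards [eventually_gt_atTop 0, hlim.eventually (gt_mem_nhds hε)] with ξ hξ h k hk
  have hInt := integrableOn_phaseDefect hj hl hjδ hδ hk
  have hsinh : 0 < Real.sinh ξ := Real.sinh_pos_iff.2 hξ
  rw [localPhase_sub_phase hj hl hjδ hδ hk hξ, dist_eq_norm,
    ← intervalIntegral.integral_Ioi_sub_Ioi hInt hsinh.le, sub_sub_cancel]
  refine lt_of_le_of_lt (norm_integral_le_of_norm_le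
    (integrable_inv_one_add_sq.integrableOn.const_mul C) ?_) ?_
  · filter_upwards [ae_restrict_mem measurableSet_Ioi] with τ hτ using
      hC τ (hsinh.trans hτ) k hk
  · rwa [integral_const_mul, integral_Ioi_inv_one_add_sq]

theorem differentiableOn_integral_phaseDefect (hj : 1 ≤ j) (hl : IsLongRangePart Z μ j l)
    (hjδ : 1 / (j : ℝ) < δ ^ 2) (hδ : 0 < δ) :
    DifferentiableOn ℂ (fun k => ∫ τ in Ioi (0 : ℝ), phaseDefect Z l k τ) {k | δ < ‖k‖} := by
  obtain ⟨C, -, hC⟩ := exists_norm_phaseDefect_le hj hl hδ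
  refine differentiableOn_integral_of_dominated (isOpen_lt continuous_const continuous_norm)
    (bound := fun τ => C * (1 + τ ^ 2)⁻¹) (fun k hk =>
      (continuousOn_phaseDefect hl hjδ hδ (le_of_lt hk)).aestronglyMeasurable measurableSet_Ioi)
    ?_ ?_ (integrable_inv_one_add_sq.integrableOn.const_mul C)
  · filter_upwards [ae_restrict_mem measurableSet_Ioi] with τ hτ k hk
    have hk' : δ < ‖k‖ := hk
    have hk0 : k ≠ 0 := norm_pos_iff.1 (hδ.trans hk')
    have h1 := one_sub_div_sq_mem_slitPlane hl hjδ hδ hk'.le hτ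
    have h2 : 2 * k ≠ 0 := mul_ne_zero two_ne_zero hk0
    have h3 : k ^ 2 ≠ 0 := pow_ne_zero _ hk0
    have h4 : DifferentiableAt ℂ (fun k : ℂ => (1 - (l τ : ℂ) / k ^ 2) ^ (1 / 2 : ℂ)) k :=
      DifferentiableAt.cpow (by fun_prop (disch := assumption)) (by fun_prop) h1
    apply DifferentiableAt.differentiableWithinAt
    unfold phaseDefect
    fun_prop (disch := assumption)
  · filter_upwards [ae_restrict_mem measurableSet_Ioi] with τ hτ k hk using
      hC τ hτ k (le_of_lt hk)

theorem IsGlobalPhase.exists_tendstoUniformlyOn_sub_phase {φ : ℝ → ℂ → ℂ}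
    (hφ : IsGlobalPhase Z μ φ) (hδ : 0 < δ) :
    ∃ Θ : ℂ → ℂ, DifferentiableOn ℂ Θ {k | δ < ‖k‖} ∧
      TendstoUniformlyOn (fun ξ k => φ ξ k - phase Z ξ k) Θ atTop {k | δ ≤ ‖k‖} := by
  -- The level $j=n+1$ is taken so large that $\{|k|\ge\delta\}\subset\Omega_j$.
  obtain ⟨n, hn⟩ := exists_nat_one_div_lt (show 0 < δ ^ 2 by positivity)
  have hjδ : 1 / ((n + 1 : ℕ) : ℝ) < δ ^ 2 := by exact_mod_cast hn
  have hj : 1 ≤ n + 1 := by omega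
  obtain ⟨l, hl, g, hg, R, hR⟩ := hφ.patch (n + 1) hj
  have hΩ : ∀ k : ℂ, δ ≤ ‖k‖ → k ∈ Omega (n + 1) := fun k hk =>
    hjδ.trans_le (by gcongr)
  refine ⟨fun k => (∫ τ in Ioi (0 : ℝ), phaseDefect Z l k τ) + g k,
    (differentiableOn_integral_phaseDefect hj hl hjδ hδ).add
      (hg.differentiableOn.mono fun k hk => hΩ k (le_of_lt hk)), ?_⟩
  have h := tendstoUniformlyOn_localPhase_sub_phase hj hl hjδ hδ
  rw [Metric.tendstoUniformlyOn_iff] at h ⊢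
  intro ε hε
  filter_upwards [h ε hε, eventually_gt_atTop R] with ξ h1 h2 k hk
  have := h1 k hk
  rw [dist_eq_norm] at this ⊢
  rw [hR ξ h2 k (hΩ k hk)]
  convert this using 2
  ring

/-- A global phase function differs from the comparison phase by a function of `k` that is analytic
outside `0`, up to an error that vanishes uniformly outside every disc around `0`. -/
theorem IsGlobalPhase.exists_limit_sub_phase {φ : ℝ → ℂ → ℂ} (hφ : IsGlobalPhase Z μ φ) :
    ∃ Θ : ℂ → ℂ, DifferentiableOn ℂ Θ {0}ᶜ ∧ ∀ δ : ℝ, 0 < δ →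
      TendstoUniformlyOn (fun ξ k => φ ξ k - phase Z ξ k) Θ atTop {k | δ ≤ ‖k‖} := by
  choose Θ hd hu using fun (δ : {δ : ℝ // 0 < δ}) => hφ.exists_tendstoUniformlyOn_sub_phase δ.2
  have hlim : ∀ k : ℂ, k ≠ 0 → ∃ a, Tendsto (fun ξ => φ ξ k - phase Z ξ k) atTop (𝓝 a) :=
    fun k hk => ⟨_, (hu ⟨‖k‖, norm_pos_iff.2 hk⟩).tendsto_at (le_refl ‖k‖)⟩
  have hlim' : ∀ k : ℂ, ∃ a, k ≠ 0 → Tendsto (fun ξ => φ ξ k - phase Z ξ k) atTop (𝓝 a) := by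
    intro k
    by_cases hk : k = 0
    · exact ⟨0, fun h => absurd hk h⟩
    · exact (hlim k hk).imp fun a ha _ => ha
  choose Θ₀ hΘ₀ using hlim'
  -- Uniqueness of pointwise limits glues the functions found for the various $\delta$; the value at
  -- $0$ is arbitrary.
  have heq : ∀ (δ : ℝ) (hδ : 0 < δ) (k : ℂ), δ ≤ ‖k‖ → Θ ⟨δ, hδ⟩ k = Θ₀ k := fun δ hδ k hk =>
    tendsto_nhds_unique ((hu ⟨δ, hδ⟩).tendsto_at hk) (hΘ₀ k (norm_pos_iff.1 (hδ.trans_le hk)))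
  refine ⟨Θ₀, fun k hk => ?_, fun δ hδ => (hu ⟨δ, hδ⟩).congr_right fun k hk => heq δ hδ k hk⟩
  have hk0 : 0 < ‖k‖ := norm_pos_iff.2 hk
  have hδ : 0 < ‖k‖ / 2 := by linarith
  have hmem : {k' : ℂ | ‖k‖ / 2 < ‖k'‖} ∈ 𝓝 k :=
    (isOpen_lt continuous_const continuous_norm).mem_nhds (half_lt_self hk0)
  refine DifferentiableAt.differentiableWithinAt
    (((hd ⟨‖k‖ / 2, hδ⟩).differentiableAt hmem).congr_of_eventuallyEq ?_)
  filter_upwards [hmem] with k' hk'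
  exact (heq _ hδ k' (le_of_lt hk')).symm

end PhaseLimit

/-! ### From the comparison function to the prescribed leading term, for both signs -/

section Asymptotics

variable {Z σ : ℝ} {μ : ℂ}

theorem leadingTerm_ne_zero (σ : ℝ) (φ : ℝ → ℂ → ℂ) (ξ : ℝ) (k : ℂ) :
    leadingTerm σ φ ξ k ≠ 0 := by
  refine mul_ne_zero ?_ (Complex.exp_ne_zero _)
  have : 0 < Real.sqrt 2 * Real.exp (-ξ / 2) := by positivity
  exact_mod_cast this.ne'

theorem phase_sign_mul (hσ : σ = 1 ∨ σ = -1) (Z ξ : ℝ) (k : ℂ) :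
    phase Z ξ (σ * k) = σ * phase Z ξ k := by
  rcases hσ with rfl | rfl
  · simp
  · simpa using phase_neg Z ξ k

theorem IsRadialPair.of_sign_mul (hσ : σ = 1 ∨ σ = -1) {k : ℂ} {v v' : ℝ → ℂ}
    (h : IsRadialPair Z μ (σ * k) v v') : IsRadialPair Z μ k v v' := by
  rcases hσ with rfl | rfl
  · simpa using h
  · exact IsRadialPair.of_neg (by simpa using h)

theorem IsRadialPair.sign_mul (hσ : σ = 1 ∨ σ = -1) {k : ℂ} {v v' : ℝ → ℂ}
    (h : IsRadialPair Z μ k v v') : IsRadialPair Z μ (σ * k) v v' := by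
  refine IsRadialPair.of_sign_mul (k := σ * k) hσ ?_
  rcases hσ with rfl | rfl <;> simpa using h

/-- The ratio of the amplitudes of the comparison function and of the leading term. -/
def amplitudeRatio (ξ : ℝ) : ℝ :=
  (Real.sqrt (Real.cosh ξ))⁻¹ / (Real.sqrt 2 * Real.exp (-ξ / 2))

/-- Rests on $2e^{-\xi}\cosh\xi=1+e^{-2\xi}$. -/
theorem tendsto_amplitudeRatio : Tendsto amplitudeRatio atTop (𝓝 1) := by
  have heq : ∀ ξ, amplitudeRatio ξ = (Real.sqrt (1 + Real.exp (-2 * ξ)))⁻¹ := by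
    intro ξ
    have hc := Real.cosh_pos ξ
    rw [amplitudeRatio, div_eq_mul_inv, ← mul_inv]
    congr 1
    symm
    rw [Real.sqrt_eq_iff_mul_self_eq (by positivity) (by positivity)]
    symm
    have h1 := Real.mul_self_sqrt hc.le
    have h2 := Real.mul_self_sqrt (show (0 : ℝ) ≤ 2 by norm_num)
    have h3 : Real.exp (-ξ / 2) * Real.exp (-ξ / 2) = Real.exp (-ξ) := by
      rw [← Real.exp_add]; ring_nf
    calc _ = (Real.sqrt (Real.cosh ξ) * Real.sqrt (Real.cosh ξ)) * (Real.sqrt 2 * Real.sqrt 2) *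
          (Real.exp (-ξ / 2) * Real.exp (-ξ / 2)) := by ring
      _ = Real.exp ξ * Real.exp (-ξ) + Real.exp (-ξ) * Real.exp (-ξ) := by
          rw [h1, h2, h3, Real.cosh_eq]; ring
      _ = _ := by
          rw [← Real.exp_add, ← Real.exp_add]
          ring_nf
          simp
  have h1 : Tendsto (fun ξ : ℝ => Real.exp (-2 * ξ)) atTop (𝓝 0) :=
    Real.tendsto_exp_atBot.comp (tendsto_id.const_mul_atTop_of_neg (by norm_num))
  have h2 := ((h1.const_add 1).sqrt).inv₀ (by simp)
  rw [add_zero, Real.sqrt_one, inv_one] at h2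
  exact h2.congr fun ξ => (heq ξ).symm

/-- Asymptotics with respect to the comparison function are asymptotics with respect to the leading
term of a global phase function, after multiplication by a function of `k`. -/
theorem tendsto_div_leadingTerm (hσ : σ = 1 ∨ σ = -1) {φ V : ℝ → ℂ → ℂ} {Θ : ℂ → ℂ} {ι : Type*}
    {L : Filter ι} {x : ι → ℝ} {κ : ι → ℂ} (hx : Tendsto x L atTop)
    (hV : Tendsto (fun i => V (x i) (σ * κ i) / comparison Z (x i) (σ * κ i)) L (𝓝 1))
    (hΘ : Tendsto (fun i => φ (x i) (κ i) - phase Z (x i) (κ i) - Θ (κ i)) L (𝓝 0)) :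
    Tendsto (fun i => Complex.exp (σ * Complex.I * Θ (κ i)) * V (x i) (σ * κ i) /
      leadingTerm σ φ (x i) (κ i)) L (𝓝 1) := by
  have h1 : Tendsto (fun i => (amplitudeRatio (x i) : ℂ)) L (𝓝 1) := by
    have := (Complex.continuous_ofReal.tendsto 1).comp (tendsto_amplitudeRatio.comp hx)
    simpa [Function.comp_def] using this
  have h2 : Tendsto (fun i => Complex.exp (-(σ * Complex.I) *
      (φ (x i) (κ i) - phase Z (x i) (κ i) - Θ (κ i)))) L (𝓝 1) := by
    simpa using (hΘ.const_mul (-(σ * Complex.I))).cexp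
  have h3 := (hV.mul h1).mul h2
  rw [one_mul, one_mul] at h3
  refine h3.congr fun i => ?_
  have hy := comparison_ne_zero Z (x i) (σ * κ i)
  have hl := leadingTerm_ne_zero σ φ (x i) (κ i)
  rw [div_mul_eq_mul_div, div_mul_eq_mul_div, div_eq_div_iff hy hl]
  have h4 : (amplitudeRatio (x i) : ℂ) * ((Real.sqrt 2 * Real.exp (-(x i) / 2) : ℝ) : ℂ) =
      (((Real.sqrt (Real.cosh (x i)))⁻¹ : ℝ) : ℂ) := by
    rw [← Complex.ofReal_mul, amplitudeRatio, div_mul_cancel₀ _ (by positivity)]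
  have h5 : Complex.exp (-(σ * Complex.I) * (φ (x i) (κ i) - phase Z (x i) (κ i) - Θ (κ i))) *
      Complex.exp (σ * Complex.I * φ (x i) (κ i)) =
      Complex.exp (σ * Complex.I * Θ (κ i)) *
        Complex.exp (Complex.I * phase Z (x i) (σ * κ i)) := by
    rw [← Complex.exp_add, ← Complex.exp_add, phase_sign_mul hσ]
    ring_nf
  rw [leadingTerm, comparison]
  linear_combination (V (x i) (σ * κ i)) *
    (Complex.exp (-(σ * Complex.I) * (φ (x i) (κ i) - phase Z (x i) (κ i) - Θ (κ i))) *
      Complex.exp (σ * Complex.I * φ (x i) (κ i)) * h4 +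
      (((Real.sqrt (Real.cosh (x i)))⁻¹ : ℝ) : ℂ) * h5)

theorem norm_sign_mul (hσ : σ = 1 ∨ σ = -1) (k : ℂ) : ‖(σ : ℂ) * k‖ = ‖k‖ := by
  rcases hσ with rfl | rfl <;> simp

theorem sign_ne_zero (hσ : σ = 1 ∨ σ = -1) : (σ : ℂ) ≠ 0 := by
  rcases hσ with rfl | rfl <;> simp

theorem im_nonneg_of_mem_closure_halfPlane {k : ℂ} (hk : k ∈ closure (halfPlane σ)) :
    0 ≤ ((σ : ℂ) * k).im := by
  have hcl : IsClosed {k : ℂ | 0 ≤ σ * k.im} :=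
    isClosed_le continuous_const (continuous_const.mul Complex.continuous_im)
  have hsub : halfPlane σ ⊆ {k : ℂ | 0 ≤ σ * k.im} := fun z hz =>
    (le_of_lt hz : 0 ≤ σ * z.im)
  have : k ∈ {k : ℂ | 0 ≤ σ * k.im} := closure_minimal hsub hcl hk
  rw [Complex.im_ofReal_mul]
  exact this

theorem differentiableAt_comparison (Z ξ : ℝ) {k : ℂ} (hk : k ≠ 0) :
    DifferentiableAt ℂ (comparison Z ξ) k := by
  have h2 : 2 * k ≠ 0 := mul_ne_zero two_ne_zero hk
  unfold comparison phase
  fun_prop (disch := assumption)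

end Asymptotics

end TwoCentre

end

/-! ### Assembly of the family and its four properties -/

theorem theorem4p3 (Z : ℝ) (μ : ℂ) (φ : ℝ → ℂ → ℂ) (hφ : TwoCentre.IsGlobalPhase Z μ φ)
    (σ : ℝ) (hσ : σ = 1 ∨ σ = -1) :
    ∃ v : ℝ → ℂ → ℂ,
      -- existence, for every nonzero `k`
      (∀ k : ℂ, k ≠ 0 →
        TwoCentre.IsRadialSolution Z μ k (fun ξ => v ξ k) ∧
        TwoCentre.HasAsymptotics σ φ k (fun ξ => v ξ k)) ∧
      -- uniqueness, on the closed half-plane without `0`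
      (∀ k ∈ closure (TwoCentre.halfPlane σ) \ {0}, ∀ w : ℝ → ℂ,
        TwoCentre.IsRadialSolution Z μ k w → TwoCentre.HasAsymptotics σ φ k w →
        ∀ ξ : ℝ, 0 < ξ → w ξ = v ξ k) ∧
      -- uniformity of the asymptotics in truncated cones
      (∀ η δ : ℝ, 0 ≤ η → 0 < δ →
        TendstoUniformlyOn (fun (ξ : ℝ) (k : ℂ) => v ξ k / TwoCentre.leadingTerm σ φ ξ k)
          (fun _ => 1) atTop (TwoCentre.truncatedCone σ η δ)) ∧
      -- analyticity in the open half-plane, continuity up to the boundary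
      (∀ ξ : ℝ, 0 < ξ → AnalyticOnNhd ℂ (fun k => v ξ k) (TwoCentre.halfPlane σ)) ∧
      (∀ ξ : ℝ, 0 < ξ →
        ContinuousOn (fun k => v ξ k) (closure (TwoCentre.halfPlane σ) \ {0})) := by
  open TwoCentre in
  obtain ⟨V, hV, hVeq⟩ := exists_jost_solution Z μ
  obtain ⟨Θ, hΘd, hΘu⟩ := hφ.exists_limit_sub_phase
  have hσ0 := sign_ne_zero hσ
  have hΘlim : ∀ k : ℂ, k ≠ 0 →
      Tendsto (fun ξ => φ ξ k - phase Z ξ k - Θ k) atTop (𝓝 0) := by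
    intro k hk
    have := ((hΘu ‖k‖ (norm_pos_iff.2 hk)).tendsto_at (le_refl ‖k‖)).sub_const (Θ k)
    rwa [sub_self] at this
  have hasymp : ∀ k : ℂ, k ≠ 0 → HasAsymptotics σ φ k
      (fun ξ => Complex.exp (σ * Complex.I * Θ k) * V ξ (σ * k)) := fun k hk =>
    tendsto_div_leadingTerm hσ (x := fun ξ => ξ) (κ := fun _ => k) tendsto_id
      (hV _ (mul_ne_zero hσ0 hk)).2 (hΘlim k hk)
  refine ⟨fun ξ k => Complex.exp (σ * Complex.I * Θ k) * V ξ (σ * k), ?_, ?_, ?_, ?_, ?_⟩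
  · intro k hk
    obtain ⟨v', hv'⟩ := (hV _ (mul_ne_zero hσ0 hk)).1
    exact ⟨⟨_, (hv'.of_sign_mul hσ).const_mul _⟩, hasymp k hk⟩
  · rintro k ⟨hkc, hk0⟩ w ⟨w', hw⟩ hwa ξ hξ
    have hk0' : k ≠ 0 := hk0
    have hσk := mul_ne_zero hσ0 hk0'
    obtain ⟨⟨v', hv'⟩, hvlim⟩ := hV _ hσk
    have hw' : IsRadialPair Z μ k w w' := hw
    have hvc : Tendsto (fun ξ => Complex.exp (σ * Complex.I * Θ k) * V ξ (σ * k) /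
        comparison Z ξ (σ * k)) atTop (𝓝 (Complex.exp (σ * Complex.I * Θ k))) := by
      have := hvlim.const_mul (Complex.exp (σ * Complex.I * Θ k))
      rw [mul_one] at this
      exact this.congr fun ξ => (mul_div_assoc _ _ _).symm
    have hva := hasymp k hk0'
    have hwc : Tendsto (fun ξ => w ξ / comparison Z ξ (σ * k)) atTop
        (𝓝 (Complex.exp (σ * Complex.I * Θ k))) := by
      -- Dividing the two asymptotics eliminates the leading term, so $w$ is compared with $y$
      -- through $v$.
      have h1 := (hwa.mul (hva.inv₀ one_ne_zero)).mul hvc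
      rw [inv_one, one_mul, one_mul] at h1
      refine h1.congr' ?_
      filter_upwards [hva.eventually_ne one_ne_zero] with ξ hξ
      have hne : Complex.exp (σ * Complex.I * Θ k) * V ξ (σ * k) ≠ 0 := by
        intro h0
        apply hξ
        rw [h0, zero_div]
      have hl := leadingTerm_ne_zero σ φ ξ k
      rw [inv_div, div_mul_div_cancel₀ hl, div_mul_div_cancel₀ hne]
    exact IsRadialPair.eq_of_tendsto hσk (im_nonneg_of_mem_closure_halfPlane hkc)
      (hw'.sign_mul hσ) (hv'.const_mul _) hwc hvc ξ hξ
  · intro η δ hη hδ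
    have hcone : ∀ k ∈ truncatedCone σ η δ, (σ : ℂ) * k ∈ upperDomain δ := fun k hk =>
      ⟨Complex.arg_nonneg_iff.1 (hη.trans hk.2.1), by rw [norm_sign_mul hσ]; exact hk.2.2.2⟩
    -- Uniform convergence to a constant is convergence along a product filter, so
    -- `tendsto_div_leadingTerm` applies as it did for fixed $k$.
    rw [← tendsto_prod_principal_iff]
    refine tendsto_div_leadingTerm (Z := Z) hσ (x := Prod.fst) (κ := Prod.snd) tendsto_fst ?_ ?_
    · have h1 := tendsto_prod_principal_iff.2 (tendstoUniformlyOn_jostFactor Z μ hδ)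
      have h2 : Tendsto (fun p : ℝ × ℂ => (p.1, (σ : ℂ) * p.2))
          (atTop ×ˢ 𝓟 (truncatedCone σ η δ)) (atTop ×ˢ 𝓟 (upperDomain δ)) :=
        tendsto_id.prodMap (tendsto_principal_principal.2 hcone)
      refine (h1.comp h2).congr' ?_
      have hmem : ∀ᶠ p : ℝ × ℂ in atTop ×ˢ 𝓟 (truncatedCone σ η δ),
          p.2 ∈ truncatedCone σ η δ := tendsto_snd.eventually (mem_principal_self _)
      filter_upwards [hmem] with p hp
      rw [hVeq _ _ (hcone _ hp).1, mul_div_cancel_left₀ _ (comparison_ne_zero _ _ _)]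
      rfl
    · have h1 : TendstoUniformlyOn (fun ξ k => φ ξ k - phase Z ξ k - Θ k) (fun _ => 0) atTop
          (truncatedCone σ η δ) := by
        have h2 := (hΘu δ hδ).mono (fun k (hk : k ∈ truncatedCone σ η δ) => hk.2.2.2)
        rw [Metric.tendstoUniformlyOn_iff] at h2 ⊢
        intro ε hε
        filter_upwards [h2 ε hε] with ξ h k hk
        rw [dist_comm, dist_zero_right, ← dist_eq_norm, dist_comm]
        exact h k hk
      exact tendsto_prod_principal_iff.2 h1
  · intro ξ hξ
    have hopen : IsOpen (halfPlane σ) :=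
      isOpen_lt continuous_const (continuous_const.mul Complex.continuous_im)
    refine DifferentiableOn.analyticOnNhd (fun k hk => ?_) hopen
    have hk0 : k ≠ 0 := by
      rintro rfl
      simp [halfPlane] at hk
    have him : 0 < ((σ : ℂ) * k).im := by rw [Complex.im_ofReal_mul]; exact hk
    have hnorm : 0 < ‖k‖ := norm_pos_iff.2 hk0
    have hU : IsOpen {k' : ℂ | 0 < k'.im ∧ ‖k‖ / 2 < ‖k'‖} :=
      (isOpen_lt continuous_const Complex.continuous_im).inter
        (isOpen_lt continuous_const continuous_norm)
    have h1 : DifferentiableAt ℂ (jostFactor Z μ ξ) (σ * k) :=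
      (differentiableOn_jostFactor (half_pos hnorm) hξ).differentiableAt
        (hU.mem_nhds ⟨him, by rw [norm_sign_mul hσ]; linarith⟩)
    have h2 := differentiableAt_comparison Z ξ (mul_ne_zero hσ0 hk0)
    have h3 : DifferentiableAt ℂ Θ k := hΘd.differentiableAt (isOpen_compl_singleton.mem_nhds hk0)
    have h4 : DifferentiableAt ℂ (fun k : ℂ => (σ : ℂ) * k) k := by fun_prop
    have h5 : DifferentiableAt ℂ (fun k => Complex.exp (σ * Complex.I * Θ k) *
        (comparison Z ξ (σ * k) * jostFactor Z μ ξ (σ * k))) k :=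
      (h3.const_mul _).cexp.mul ((h2.comp k h4).mul (h1.comp k h4))
    refine (h5.congr_of_eventuallyEq ?_).differentiableWithinAt
    filter_upwards [hopen.mem_nhds hk] with k' hk'
    rw [hVeq _ _ (by rw [Complex.im_ofReal_mul]; exact le_of_lt hk')]
  · intro ξ hξ
    suffices h : ContinuousOn (fun k => Complex.exp (σ * Complex.I * Θ k) *
        (comparison Z ξ (σ * k) * jostFactor Z μ ξ (σ * k))) (closure (halfPlane σ) \ {0}) from
      h.congr fun k hk => by
        dsimp only
        rw [hVeq _ _ (im_nonneg_of_mem_closure_halfPlane hk.1)]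
    have h1 : ContinuousOn Θ (closure (halfPlane σ) \ {0}) :=
      hΘd.continuousOn.mono fun k hk => hk.2
    have h2 : ContinuousOn (fun k => comparison Z ξ (σ * k)) (closure (halfPlane σ) \ {0}) :=
      fun k hk => (ContinuousAt.comp (f := fun k : ℂ => (σ : ℂ) * k)
        (differentiableAt_comparison Z ξ (mul_ne_zero hσ0 hk.2)).continuousAt
        (by fun_prop)).continuousWithinAt
    have h3 : ContinuousOn (fun k => jostFactor Z μ ξ (σ * k)) (closure (halfPlane σ) \ {0}) := by
      -- Continuity of $m$ is known only away from discs around $0$; near $k$ the radius $|k|/2$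
      -- serves.
      refine continuousOn_of_locally_continuousOn fun k hk => ?_
      have hnorm : 0 < ‖k‖ := norm_pos_iff.2 hk.2
      refine ⟨{k' : ℂ | ‖k‖ / 2 < ‖k'‖}, isOpen_lt continuous_const continuous_norm,
        half_lt_self hnorm, ?_⟩
      exact (continuousOn_jostFactor (half_pos hnorm)).comp
        (f := fun k' : ℂ => (ξ, (σ : ℂ) * k')) (by fun_prop) fun k' hk' =>
          ⟨hξ, im_nonneg_of_mem_closure_halfPlane hk'.1.1,
            by rw [norm_sign_mul hσ]; exact le_of_lt hk'.2⟩
    exact (h1.const_smul (σ * Complex.I)).cexp.mul (h2.mul h3)
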